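/- **Theorem 4.3.** Let $K$ be a field, $Q$ a quiver with finite vertex set, and $I$ a two-sided ideal of the path algebra $KQ$ (where $ab$ denotes the arrow $a$ followed by the arrow $b$) such that $A=KQ/I$ is finite dimensional and almost gentle, i.e. - $I$ is generated by paths of length $2$; - for every arrow $a$ of $Q$ there is at most one arrow $b$ with $ab\notin I$ and at most one arrow $c$ with $ca\notin I$. A path $m$ of $Q$ (possibly trivial) is called maximal if $m\notin I$ and $am\in I$, $ma\in I$ for every arrow $a$ of $Q$; let $\mathcal M$ be the set of maximal paths. Let $Q^*$ be the quiver with the same vertices as $Q$ and with arrows those of $Q$ together with one new arrow $a_m$, from the end vertex of $m$ to the start vertex of $m$, for each $m\in\mathcal M$. Let $\mathcal S$ be the set of all cyclic permutations of the cycles $C_m=m\,a_m$, $m\in\mathcal M$, and let $A^*=KQ^*/I^*$ be the algebra defined by cycles $(\mathcal S,\mu)$ with $\mu\equiv 1$; that is, $I^*$ is the two-sided ideal of $KQ^*$ generated by 1. $C-C'$, for $C,C'\in\mathcal S$ cycles at the same vertex; 2. $Ca$, for $C\in\mathcal S$ with first arrow $a$; 3. $ab$, for arrows $a,b$ of $Q^*$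 such that $ab$ does not lie on any $C\in\mathcal S$. Let $T(A)=A\ltimes D(A)$ be the trivial extension of $A$ by $D(A)=\operatorname{Hom}_K(A,K)$: the vector space $A\oplus D(A)$ with multiplication $(a,f)(b,g)=(ab,\,ag+fb)$, where $(ag)(x)=g(xa)$ and $(fb)(x)=f(bx)$. Then $A^*$ and $T(A)$ are isomorphic as $K$-algebras. -/

import Mathlib

universe u w z

noncomputable section

namespace AlmostGentle

open Quiver TrivSqZeroExt MulOpposite

section PathAlgebraDefs

/-- A path of a quiver together with its start and end vertices. Trivial paths are included. -/
structure BPath (V : Type u) [Quiver.{w} V] where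
  /-- the start vertex `s(p)` -/
  src : V
  /-- the end vertex `t(p)` -/
  tgt : V
  /-- the path itself -/
  path : Path src tgt

/-- The path algebra `KQ`: the `K`-vector space with basis the set of all (directed, finite) paths
of the quiver `V`, trivial ones included. -/
def PathAlgebra (K : Type z) [Field K] (V : Type u) [Quiver.{w} V] : Type (max u w z) :=
  BPath V →₀ K

variable {K : Type z} [Field K] {V : Type u} [Quiver.{w} V]

namespace PathAlgebra

instance : AddCommGroup (PathAlgebra K V) := inferInstanceAs (AddCommGroup (BPath V →₀ K))

instance : Module K (PathAlgebra K V) := inferInstanceAs (Module K (BPath V →₀ K))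

variable (K V) in
/-- The paths form a basis of the path algebra. -/
def basis : Module.Basis (BPath V) K (PathAlgebra K V) :=
  Module.Basis.ofRepr (LinearEquiv.refl K (BPath V →₀ K) : PathAlgebra K V ≃ₗ[K] (BPath V →₀ K))

variable (K) in
/-- The basis element given by a path. -/
def of {v v' : V} (p : Path v v') : PathAlgebra K V := basis K V ⟨v, v', p⟩

open Classical in
variable (K) in
/-- The product of two basis elements: the concatenation `pq` (first `p`, then `q`) if `p` ends
where `q` starts, and `0` otherwise. -/
def pathMul (p q : BPath V) : PathAlgebra K V :=
  if h : q.src = p.tgt then of K (p.path.comp (q.path.cast h rfl)) else 0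

/-- The bilinear extension of the product of paths. -/
def mulLin : PathAlgebra K V →ₗ[K] PathAlgebra K V →ₗ[K] PathAlgebra K V :=
  (basis K V).constr K fun p => (basis K V).constr K fun q => pathMul K p q

instance : Mul (PathAlgebra K V) := ⟨fun x y => mulLin x y⟩

/-- The unit is the sum of the trivial paths. -/
instance [Fintype V] : One (PathAlgebra K V) := ⟨∑ v : V, of K (Path.nil : Path v v)⟩

theorem mul_def (x y : PathAlgebra K V) : x * y = mulLin x y := rfl

theorem one_def [Fintype V] :
    (1 : PathAlgebra K V) = ∑ v : V, of K (Path.nil : Path v v) := rfl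

theorem mulLin_of {a b c d : V} (p : Path a b) (q : Path c d) :
    mulLin (of K p) (of K q) = pathMul K ⟨a, b, p⟩ ⟨c, d, q⟩ := by
  simp only [mulLin, of, Module.Basis.constr_basis]

theorem of_mul_of {a b c : V} (p : Path a b) (q : Path b c) :
    of K p * of K q = of K (p.comp q) := by
  rw [mul_def, mulLin_of]
  simp [pathMul]

theorem of_mul_of_ne {a b c d : V} (p : Path a b) (q : Path c d) (h : c ≠ b) :
    of K p * of K q = 0 := by
  rw [mul_def, mulLin_of]
  simp [pathMul, h]

@[elab_as_elim]
theorem induction {P : PathAlgebra K V → Prop} (x : PathAlgebra K V) (h0 : P 0)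
    (hadd : ∀ x y, P x → P y → P (x + y)) (hsmul : ∀ (c : K) x, P x → P (c • x))
    (hof : ∀ (a b : V) (p : Path a b), P (of K p)) : P x := by
  have hx : x ∈ Submodule.span K (Set.range (basis K V)) := by
    rw [(basis K V).span_eq]
    trivial
  induction hx using Submodule.span_induction with
  | mem y hy =>
    obtain ⟨⟨a, b, p⟩, rfl⟩ := hy
    exact hof a b p
  | zero => exact h0
  | add y t _ _ hy ht => exact hadd y t hy ht
  | smul c y _ hy => exact hsmul c y hy

protected theorem zero_mul (x : PathAlgebra K V) : 0 * x = 0 := by simp [mul_def]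

protected theorem mul_zero (x : PathAlgebra K V) : x * 0 = 0 := by simp [mul_def]

protected theorem left_distrib (x y t : PathAlgebra K V) : x * (y + t) = x * y + x * t := by
  simp [mul_def]

protected theorem right_distrib (x y t : PathAlgebra K V) : (x + y) * t = x * t + y * t := by
  simp [mul_def]

protected theorem smul_mul (c : K) (x y : PathAlgebra K V) : c • x * y = c • (x * y) := by
  simp [mul_def]

protected theorem mul_smul' (c : K) (x y : PathAlgebra K V) : x * c • y = c • (x * y) := by
  simp [mul_def]

protected theorem mul_assoc' (x y t : PathAlgebra K V) : x * y * t = x * (y * t) := by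
  induction x using induction with
  | h0 => simp only [PathAlgebra.zero_mul]
  | hadd x x' hx hx' => simp only [PathAlgebra.right_distrib, hx, hx']
  | hsmul c x hx => simp only [PathAlgebra.smul_mul, hx]
  | hof a b p =>
    induction y using induction with
    | h0 => simp only [PathAlgebra.zero_mul, PathAlgebra.mul_zero]
    | hadd x x' hx hx' => simp only [PathAlgebra.right_distrib, PathAlgebra.left_distrib, hx, hx']
    | hsmul c x hx => simp only [PathAlgebra.smul_mul, PathAlgebra.mul_smul', hx]
    | hof c d q =>
      induction t using induction with
      | h0 => simp only [PathAlgebra.mul_zero]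
      | hadd x x' hx hx' => simp only [PathAlgebra.left_distrib, hx, hx']
      | hsmul c x hx => simp only [PathAlgebra.mul_smul', hx]
      | hof e f r =>
        by_cases h1 : c = b
        · subst h1
          by_cases h2 : e = d
          · subst h2
            simp only [of_mul_of, Path.comp_assoc]
          · simp only [of_mul_of, of_mul_of_ne _ _ h2, PathAlgebra.mul_zero]
        · by_cases h2 : e = d
          · subst h2
            simp only [of_mul_of, of_mul_of_ne _ _ h1, PathAlgebra.zero_mul]
          · simp only [of_mul_of_ne _ _ h1, of_mul_of_ne _ _ h2, PathAlgebra.zero_mul,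
              PathAlgebra.mul_zero]

protected theorem one_mul' [Fintype V] (x : PathAlgebra K V) : 1 * x = x := by
  induction x using induction with
  | h0 => simp only [PathAlgebra.mul_zero]
  | hadd x x' hx hx' => simp only [PathAlgebra.left_distrib, hx, hx']
  | hsmul c x hx => simp only [PathAlgebra.mul_smul', hx]
  | hof a b p =>
    rw [mul_def, one_def, map_sum, LinearMap.sum_apply, Finset.sum_eq_single a]
    · rw [← mul_def, of_mul_of, Path.nil_comp]
    · intro v _ hv
      exact of_mul_of_ne _ _ (Ne.symm hv)
    · simp

protected theorem mul_one' [Fintype V] (x : PathAlgebra K V) : x * 1 = x := by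
  induction x using induction with
  | h0 => simp only [PathAlgebra.zero_mul]
  | hadd x x' hx hx' => simp only [PathAlgebra.right_distrib, hx, hx']
  | hsmul c x hx => simp only [PathAlgebra.smul_mul, hx]
  | hof a b p =>
    rw [mul_def, one_def, map_sum, Finset.sum_eq_single b]
    · rw [← mul_def, of_mul_of, Path.comp_nil]
    · intro v _ hv
      exact of_mul_of_ne _ _ hv
    · simp

instance [Fintype V] : Ring (PathAlgebra K V) where
  __ := (inferInstance : AddCommGroup (PathAlgebra K V))
  left_distrib := PathAlgebra.left_distrib
  right_distrib := PathAlgebra.right_distrib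
  zero_mul := PathAlgebra.zero_mul
  mul_zero := PathAlgebra.mul_zero
  mul_assoc := PathAlgebra.mul_assoc'
  one_mul := PathAlgebra.one_mul'
  mul_one := PathAlgebra.mul_one'

instance [Fintype V] : Algebra K (PathAlgebra K V) :=
  Algebra.ofModule PathAlgebra.smul_mul PathAlgebra.mul_smul'

variable (K) in
/-- The basis element given by an arrow, for arrows with bundled end points. -/
def ofArrow (a : Quiver.Total V) : PathAlgebra K V := of K a.hom.toPath

end PathAlgebra

end PathAlgebraDefs

section AlmostGentleDefs

variable {K : Type z} [Field K] {V : Type u} [Quiver.{w} V] [Fintype V]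

open PathAlgebra

/-- The quotient algebra `KQ/I`. -/
abbrev QuotAlgebra (I : TwoSidedIdeal (PathAlgebra K V)) : Type (max u w z) :=
  I.ringCon.Quotient

/-- The conditions (S0) and (S1) on a presentation `KQ/I` of an almost gentle algebra. A product of
two arrows that do not compose is `0` in `KQ`, hence lies in `I`. (If `KQ/I` is also finite
dimensional, then `I` is admissible.) -/
structure IsAlmostGentle (I : TwoSidedIdeal (PathAlgebra K V)) : Prop where
  /-- `I` is generated by paths of length two. -/
  generated : ∃ R : Set (BPath V), (∀ p ∈ R, p.path.length = 2) ∧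
    I = TwoSidedIdeal.span ((fun p : BPath V => of K p.path) '' R)
  /-- For every arrow `a` there is at most one arrow `b` with `ab ∉ I`. -/
  right_unique : ∀ a b b' : Quiver.Total V,
    ofArrow K a * ofArrow K b ∉ I → ofArrow K a * ofArrow K b' ∉ I → b = b'
  /-- For every arrow `a` there is at most one arrow `c` with `ca ∉ I`. -/
  left_unique : ∀ a c c' : Quiver.Total V,
    ofArrow K c * ofArrow K a ∉ I → ofArrow K c' * ofArrow K a ∉ I → c = c'

/-- A path `p` is a maximal path of `KQ/I` if `p ∉ I` and `ap ∈ I` and `pa ∈ I` for every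
arrow `a`. -/
def IsMaximalPath (I : TwoSidedIdeal (PathAlgebra K V)) {v v' : V} (p : Path v v') : Prop :=
  of K p ∉ I ∧ ∀ a : Quiver.Total V, ofArrow K a * of K p ∈ I ∧ of K p * ofArrow K a ∈ I

end AlmostGentleDefs

section Cycles

variable {V : Type u} [Quiver.{w} V]

/-- The cycle `D` is a cyclic permutation of the cycle `C`: there are paths `x`, `y` with `C = xy`
and `D = yx`. -/
def IsCyclicPerm {v v' : V} (C : Path v v) (D : Path v' v') : Prop :=
  ∃ (x : Path v v') (y : Path v' v), C = x.comp y ∧ D = y.comp x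

/-- The path `r` lies on the path `C`, i.e. is a subpath of it. -/
def LiesOn {a b v v' : V} (r : Path a b) (C : Path v v') : Prop :=
  ∃ (x : Path v a) (y : Path b v'), C = x.comp (r.comp y)

variable (K : Type z) [Field K] [Fintype V]

open PathAlgebra

/-- The relations of Types 1, 2 and 3 attached to a set `S` of cycles (`S v` is the set of those
that start and end at `v`) and a multiplicity function `μ : S → ℤ_{>0}`. -/
inductive CycleRel (S : ∀ v : V, Set (Path v v)) (μ : ∀ v : V, S v → ℕ+) : PathAlgebra K V → Prop
  /-- Type 1: `C^{μ(C)} - C'^{μ(C')}` for `C`, `C'` in `S` at the same vertex. -/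
  | type1 (v : V) (C C' : S v) :
      CycleRel S μ (of K C.1 ^ (μ v C : ℕ) - of K C'.1 ^ (μ v C' : ℕ))
  /-- Type 2: `C^{μ(C)} a` for `C` in `S` with first arrow `a`. -/
  | type2 (v : V) (C : S v) (v' : V) (a : v ⟶ v') (q : Path v' v) (h : C.1 = a.toPath.comp q) :
      CycleRel S μ (of K C.1 ^ (μ v C : ℕ) * of K a.toPath)
  /-- Type 3: `ab` for composable arrows `a`, `b` such that `ab` lies on no cycle in `S`. -/
  | type3 (v₁ v₂ v₃ : V) (a : v₁ ⟶ v₂) (b : v₂ ⟶ v₃)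
      (h : ∀ (v : V) (C : S v), ¬ LiesOn (a.toPath.comp b.toPath) C.1) :
      CycleRel S μ (of K a.toPath * of K b.toPath)

/-- The algebra defined by cycles `(S, μ)`: the quotient of the path algebra by the two-sided ideal
generated by all relations of Types 1, 2 and 3. -/
abbrev CycleAlgebra (S : ∀ v : V, Set (Path v v)) (μ : ∀ v : V, S v → ℕ+) : Type (max u w z) :=
  QuotAlgebra (TwoSidedIdeal.span {x : PathAlgebra K V | CycleRel K S μ x})

end Cycles

section Star

variable {K : Type z} [Field K] {V : Type u} [Quiver.{w} V] [Fintype V]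

/-- The vertices of the quiver `Q^*`: the same as those of `Q`. -/
def StarQuiver (_I : TwoSidedIdeal (PathAlgebra K V)) : Type u := V

variable (I : TwoSidedIdeal (PathAlgebra K V))

instance : Fintype (StarQuiver I) := inferInstanceAs (Fintype V)

/-- The arrows of `Q^*`: those of `Q`, together with one arrow `a_m` from the end vertex of `m` to
the start vertex of `m` for each maximal path `m` of `KQ/I`. -/
instance : Quiver.{max u w} (StarQuiver I) where
  Hom v v' := (@Quiver.Hom V _ v v') ⊕ {m : @Path V _ v' v // IsMaximalPath I m}

/-- The inclusion of `Q` in `Q^*`. -/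
def starIncl : V ⥤q StarQuiver I where
  obj v := v
  map a := Sum.inl a

/-- The new arrow `a_m` of `Q^*`. -/
def starArrow {v v' : V} (m : Path v v') (hm : IsMaximalPath I m) :
    (starIncl I).obj v' ⟶ (starIncl I).obj v :=
  Sum.inr ⟨m, hm⟩

/-- The cycle `C_m = m a_m` in `Q^*`. -/
def starCycle {v v' : V} (m : Path v v') (hm : IsMaximalPath I m) :
    Path ((starIncl I).obj v) ((starIncl I).obj v) :=
  ((starIncl I).mapPath m).comp (starArrow I m hm).toPath

/-- The set of cycles in `Q^*` that are cyclic permutations of `C_m` for some maximal path `m`. -/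
def starCycles (x : StarQuiver I) : Set (Path x x) :=
  {C | ∃ (v v' : V) (m : Path v v') (hm : IsMaximalPath I m), IsCyclicPerm (starCycle I m hm) C}

/-- The algebra `A^*` associated to `A = KQ/I`: the algebra defined by cycles `(S, μ)` with `S` the
set of cyclic permutations of the cycles `C_m` and `μ` identically `1`. -/
abbrev StarAlgebra : Type (max u w z) := CycleAlgebra K (starCycles I) fun _ _ => 1

end Star

section TrivialExtensionDefs

variable (K : Type z) [Field K] (A : Type w) [Ring A] [Algebra K A]

/-- The `K`-linear dual `D(A) = Hom_K(A, K)`, carrying its structure of `A`-`A`-bimodule. -/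
def DualBimodule : Type (max w z) := Module.Dual K A

namespace DualBimodule

variable {K A}

instance : AddCommGroup (DualBimodule K A) := inferInstanceAs (AddCommGroup (Module.Dual K A))

instance : Module K (DualBimodule K A) := inferInstanceAs (Module K (Module.Dual K A))

instance : FunLike (DualBimodule K A) A K := inferInstanceAs (FunLike (Module.Dual K A) A K)

@[ext]
theorem ext {f g : DualBimodule K A} (h : ∀ x, f x = g x) : f = g := DFunLike.ext f g h

theorem add_apply (f g : DualBimodule K A) (x : A) : (f + g) x = f x + g x := rfl

theorem zero_apply (x : A) : (0 : DualBimodule K A) x = 0 := rfl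

theorem smul_apply (c : K) (f : DualBimodule K A) (x : A) : (c • f) x = c • f x := rfl

theorem apply_add (f : DualBimodule K A) (x y : A) : f (x + y) = f x + f y :=
  LinearMap.map_add (f : Module.Dual K A) x y

theorem apply_zero (f : DualBimodule K A) : f 0 = 0 :=
  LinearMap.map_zero (f : Module.Dual K A)

theorem apply_smul (f : DualBimodule K A) (c : K) (x : A) : f (c • x) = c • f x :=
  LinearMap.map_smul (f : Module.Dual K A) c x

/-- The left action `(af)(x) = f(xa)`. -/
instance : SMul A (DualBimodule K A) :=
  ⟨fun a f => ((f : Module.Dual K A).comp (LinearMap.mulRight K a) : Module.Dual K A)⟩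

/-- The right action `(fb)(x) = f(bx)`. -/
instance : SMul Aᵐᵒᵖ (DualBimodule K A) :=
  ⟨fun b f => ((f : Module.Dual K A).comp (LinearMap.mulLeft K (unop b)) : Module.Dual K A)⟩

theorem left_smul_apply (a : A) (f : DualBimodule K A) (x : A) : (a • f) x = f (x * a) := rfl

theorem right_smul_apply (b : Aᵐᵒᵖ) (f : DualBimodule K A) (x : A) :
    (b • f) x = f (unop b * x) := rfl

instance : Module A (DualBimodule K A) where
  one_smul f := by ext x; simp [left_smul_apply]
  mul_smul a b f := by ext x; simp [left_smul_apply, mul_assoc]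
  smul_zero a := by ext x; simp [left_smul_apply, zero_apply]
  smul_add a f g := by ext x; simp [left_smul_apply, add_apply]
  add_smul a b f := by ext x; simp [left_smul_apply, add_apply, mul_add, apply_add]
  zero_smul f := by ext x; simp [left_smul_apply, zero_apply, apply_zero]

instance : Module Aᵐᵒᵖ (DualBimodule K A) where
  one_smul f := by ext x; simp [right_smul_apply]
  mul_smul a b f := by ext x; simp [right_smul_apply, mul_assoc]
  smul_zero a := by ext x; simp [right_smul_apply, zero_apply]
  smul_add a f g := by ext x; simp [right_smul_apply, add_apply]
  add_smul a b f := by ext x; simp [right_smul_apply, add_apply, add_mul, apply_add]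
  zero_smul f := by ext x; simp [right_smul_apply, zero_apply, apply_zero]

instance : SMulCommClass A Aᵐᵒᵖ (DualBimodule K A) where
  smul_comm a b f := by ext x; simp [left_smul_apply, right_smul_apply, mul_assoc]

instance : IsScalarTower K A (DualBimodule K A) where
  smul_assoc c a f := by ext x; simp [left_smul_apply, smul_apply, apply_smul]

instance : IsScalarTower K Aᵐᵒᵖ (DualBimodule K A) where
  smul_assoc c a f := by ext x; simp [right_smul_apply, smul_apply, apply_smul]

end DualBimodule

/-- The trivial extension `T(A) = A ⋉ D(A)`: the vector space `A ⊕ D(A)` with the multiplication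
`(a, f)(b, g) = (ab, ag + fb)`. -/
abbrev TrivialExtension : Type (max w z) := TrivSqZeroExt A (DualBimodule K A)

end TrivialExtensionDefs

end AlmostGentle

end

/-! Send each vertex of $Q^*$ to its idempotent in $A$, each arrow of $Q$ to its class in $A$, and
$a_m$ to the functional $m^*\in D(A)$ that reads off the coefficient of $m$. This defines $KQ^*\to
T(A)$; it kills $I^*$, and the induced map $A^*\to T(A)$ carries a spanning family to a basis, so it
is bijective.

Since $I$ is generated by paths of length two, a path lies outside $I$ exactly when no two
consecutive arrows have product in $I$ (`of_notMem_iff`). The classes of these paths are a basis of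
$A$; as $A$ is finite dimensional there are finitely many, so each extends to a maximal path
(`exists_isMaximalPath`). The uniqueness conditions let a nontrivial path extend in only one way
(`IsMaximalList.unique`).

If $m=qpr$ is maximal, then $r\,a_m\,q$ maps to $r\,m^*q=p^*$ (`starLift_around`). In particular
every cycle of $\mathcal S$ at $x$ maps to $e_x^*$, which settles Types 1 and 2; for Type 3, a
nonzero product of two arrow values forces the two arrows to be consecutive on a cycle
(`starLift_mul_eq_zero`).

For the spanning family, the relations make every path of $Q^*$ either zero in $A^*$ or an initial
segment of a cycle $r\,a_m\,q$ (`starMk_eq_zero_or_isInitial`). An initial segment is a path $p$ of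
$Q$ outside $I$ or some $r\,a_m\,q_1$ with $q=q_1q_2$, complementary to $q_2$. The class of a
complement depends only on the path it complements (`IsComplement.starMk_eq`), so one class for $p$
and one for its complement, over all $p\notin I$, span $A^*$; their images are the $p$ and $p^*$, a
basis of $T(A)$. -/

noncomputable section

namespace AlmostGentle

open Quiver TrivSqZeroExt MulOpposite PathAlgebra

/-! ### Paths as lists of arrows -/

section Arrows

variable {V : Type u} [Quiver.{w} V]

/-- The list of arrows of a path. -/
def arrows {a : V} : ∀ {b : V}, Path a b → List (Total V)
  | _, .nil => []
  | _, .cons p e => arrows p ++ [⟨_, _, e⟩]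

@[simp] theorem arrows_nil {a : V} : arrows (Path.nil : Path a a) = [] := rfl

@[simp] theorem arrows_cons {a b c : V} (p : Path a b) (e : b ⟶ c) :
    arrows (p.cons e) = arrows p ++ [⟨b, c, e⟩] := rfl

@[simp] theorem arrows_toPath {a b : V} (e : a ⟶ b) : arrows e.toPath = [⟨a, b, e⟩] := rfl

@[simp] theorem arrows_comp {a b c : V} (p : Path a b) (q : Path b c) :
    arrows (p.comp q) = arrows p ++ arrows q := by
  induction q with
  | nil => simp
  | cons q e ih => simp [ih]

/-- Lists make paths with different endpoint types comparable without casts. A trivial path has the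
empty list, which forgets its vertex, so one endpoint must be shared here; `BPath.eq_of_arrows`
assumes a nonempty list instead. -/
theorem BPath.eq_of_arrows_left {a b c : V} (p : Path a b) (q : Path a c)
    (h : arrows p = arrows q) : (⟨a, b, p⟩ : BPath V) = ⟨a, c, q⟩ := by
  induction p generalizing c with
  | nil => cases q <;> simp_all
  | cons p e ih =>
    cases q with
    | nil => simp at h
    | cons q f =>
      obtain ⟨h1, h2⟩ := List.append_inj' h rfl
      simp only [List.cons.injEq, Total.mk.injEq, and_true] at h2
      obtain ⟨rfl, rfl, h2⟩ := h2
      obtain rfl := eq_of_heq h2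
      have := ih q h1
      simp_all

theorem BPath.eq_of_arrows_right {a b c : V} (p : Path a c) (q : Path b c)
    (h : arrows p = arrows q) : (⟨a, c, p⟩ : BPath V) = ⟨b, c, q⟩ := by
  induction p with
  | nil => cases q <;> simp_all
  | cons p e ih =>
    cases q with
    | nil => simp at h
    | cons q f =>
      obtain ⟨h1, h2⟩ := List.append_inj' h rfl
      simp only [List.cons.injEq, Total.mk.injEq, and_true] at h2
      obtain ⟨rfl, -, h2⟩ := h2
      obtain rfl := eq_of_heq h2
      have := ih q h1
      simp only [BPath.mk.injEq, true_and] at this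
      obtain ⟨rfl, this⟩ := this
      rw [eq_of_heq this]

theorem BPath.eq_of_arrows {p q : BPath V} (hp : arrows p.path ≠ [])
    (h : arrows p.path = arrows q.path) : p = q := by
  obtain ⟨a, b, p⟩ := p
  obtain ⟨c, d, q⟩ := q
  cases p with
  | nil => simp at hp
  | cons p e =>
    cases q with
    | nil => simp at h
    | cons q f =>
      have h2 := (List.append_inj' h rfl).2
      simp only [List.cons.injEq, Total.mk.injEq, and_true] at h2
      obtain ⟨rfl, rfl, h2⟩ := h2
      exact BPath.eq_of_arrows_right _ _ h

theorem arrows_eq_append {a b : V} {p : Path a b} {l₁ l₂ : List (Total V)}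
    (h : arrows p = l₁ ++ l₂) : ∃ (c : V) (p₁ : Path a c) (p₂ : Path c b),
      p = p₁.comp p₂ ∧ arrows p₁ = l₁ ∧ arrows p₂ = l₂ := by
  induction p generalizing l₂ with
  | nil =>
    simp only [arrows_nil, List.nil_eq, List.append_eq_nil_iff] at h
    exact ⟨_, .nil, .nil, rfl, by simp [h], by simp [h]⟩
  | cons p e ih =>
    rcases List.eq_nil_or_concat l₂ with rfl | ⟨l, x, rfl⟩
    · exact ⟨_, p.cons e, .nil, rfl, by simpa using h, rfl⟩
    · rw [arrows_cons, List.concat_eq_append, ← List.append_assoc] at h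
      obtain ⟨h1, h2⟩ := List.append_inj' h rfl
      obtain ⟨c, p₁, p₂, rfl, rfl, rfl⟩ := ih h1
      exact ⟨c, p₁, p₂.cons e, rfl, rfl, by simp [h2]⟩

theorem exists_eq_toPath_comp {a b : V} {p : Path a b} {e : Total V} {l : List (Total V)}
    (h : arrows p = e :: l) : ∃ (c : V) (f : a ⟶ c) (q : Path c b),
      e = ⟨a, c, f⟩ ∧ p = f.toPath.comp q ∧ arrows q = l := by
  obtain ⟨c, p₁, p₂, rfl, h₁, h₂⟩ := arrows_eq_append (l₁ := [e]) (l₂ := l) h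
  have := BPath.eq_of_arrows (p := ⟨a, c, p₁⟩) (q := ⟨_, _, e.hom.toPath⟩)
    (by simp [h₁]) (by simp [h₁])
  obtain ⟨el, er, e⟩ := e
  simp only [BPath.mk.injEq] at this
  obtain ⟨rfl, rfl, h⟩ := this
  obtain rfl := eq_of_heq h
  exact ⟨_, e, p₂, rfl, rfl, h₂⟩

theorem cons_eq_comp {a b c d : V} {p : Path a b} {e : b ⟶ d} {x : Path a c} {y : Path c d}
    (h : p.cons e = x.comp y) : (⟨c, d, y⟩ : BPath V) = ⟨d, d, .nil⟩ ∨
      ∃ y' : Path c b, y = y'.cons e ∧ p = x.comp y' := by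
  cases y with
  | nil => exact Or.inl rfl
  | cons y f =>
    rw [Path.comp_cons, Path.cons.injEq] at h
    obtain ⟨rfl, h1, h2⟩ := h
    rw [eq_of_heq h1, eq_of_heq h2]
    exact Or.inr ⟨y, rfl, rfl⟩

end Arrows

/-! ### The ideal is monomial: paths outside it are chains of arrows -/

section Quotient

variable {K : Type z} [Field K] {V : Type u} [Quiver.{w} V]

theorem PathAlgebra.repr_of {a b : V} (p : Path a b) :
    (basis K V).repr (of K p) = Finsupp.single ⟨a, b, p⟩ 1 :=
  (basis K V).repr_self _

theorem PathAlgebra.repr_of_path (p : BPath V) :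
    (basis K V).repr (of K p.path) = Finsupp.single p 1 :=
  (basis K V).repr_self _

variable [Fintype V]

/-- The quotient map `KQ → KQ/I`. -/
def quotMk (I : TwoSidedIdeal (PathAlgebra K V)) : PathAlgebra K V →ₐ[K] QuotAlgebra I :=
  I.ringCon.mkₐ K

variable {I : TwoSidedIdeal (PathAlgebra K V)}

theorem quotMk_surjective : Function.Surjective (quotMk I) := RingCon.mkₐ_surjective _

theorem quotMk_eq_iff {x y : PathAlgebra K V} : quotMk I x = quotMk I y ↔ x - y ∈ I := by
  rw [← TwoSidedIdeal.rel_iff]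
  exact RingCon.eq _

theorem quotMk_eq_zero_iff {x : PathAlgebra K V} : quotMk I x = 0 ↔ x ∈ I := by
  rw [← map_zero (quotMk I), quotMk_eq_iff, sub_zero]

variable (I) in
/-- Two arrows are related if their product is nonzero in `KQ/I`. -/
def ArrowRel (a b : Total V) : Prop := ofArrow K a * ofArrow K b ∉ I

theorem of_mem_of_not_isChain {a b : V} (p : Path a b)
    (h : ¬ (arrows p).IsChain (ArrowRel I)) : of K p ∈ I := by
  induction p with
  | nil => simp at h
  | cons p e ih =>
    by_cases hp : (arrows p).IsChain (ArrowRel I)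
    · cases p with
      | nil => simp at h
      | cons p f =>
        have hfe : of K f.toPath * of K e.toPath ∈ I := by
          by_contra hfe
          refine h ?_
          rw [arrows_cons, List.isChain_append]
          refine ⟨hp, by simp, ?_⟩
          simp only [arrows_cons, List.getLast?_append, List.getLast?_singleton,
            Option.some_or, Option.mem_def, Option.some.injEq, List.head?_cons]
          rintro _ rfl _ rfl
          exact hfe
        have : of K ((p.cons f).cons e) = of K p * (of K f.toPath * of K e.toPath) := by
          rw [of_mul_of, of_mul_of]; rfl
        rw [this]
        exact I.mul_mem_left _ _ hfe
    · have : of K (p.cons e) = of K p * of K e.toPath := by rw [of_mul_of]; rfl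
      rw [this]
      exact I.mul_mem_right _ _ (ih hp)

variable (I) in
/-- The span of the paths that contain a zero relation of length two. -/
def zeroSpan : Submodule K (PathAlgebra K V) :=
  Submodule.span K (basis K V '' {p | ¬ (arrows p.path).IsChain (ArrowRel I)})

theorem of_mem_zeroSpan {a b : V} {p : Path a b} (h : ¬ (arrows p).IsChain (ArrowRel I)) :
    of K p ∈ zeroSpan I :=
  Submodule.subset_span ⟨⟨a, b, p⟩, h, rfl⟩

theorem mul_mem_zeroSpan (x : PathAlgebra K V) {y : PathAlgebra K V} (hy : y ∈ zeroSpan I) :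
    x * y ∈ zeroSpan I ∧ y * x ∈ zeroSpan I := by
  induction hy using Submodule.span_induction with
  | mem y hy =>
    obtain ⟨⟨a, b, p⟩, hp, rfl⟩ := hy
    change x * of K p ∈ _ ∧ of K p * x ∈ _
    induction x using PathAlgebra.induction with
    | h0 => simp
    | hadd x x' h h' =>
      rw [add_mul, mul_add]
      exact ⟨add_mem h.1 h'.1, add_mem h.2 h'.2⟩
    | hsmul c x h =>
      rw [smul_mul_assoc, mul_smul_comm]
      exact ⟨Submodule.smul_mem _ _ h.1, Submodule.smul_mem _ _ h.2⟩
    | hof c d q =>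
      constructor
      · by_cases h : a = d
        · subst h
          rw [of_mul_of]
          refine of_mem_zeroSpan fun h => hp (h.infix ?_)
          rw [arrows_comp]
          exact ⟨arrows q, [], by simp⟩
        · rw [of_mul_of_ne _ _ h]; exact zero_mem _
      · by_cases h : c = b
        · subst h
          rw [of_mul_of]
          refine of_mem_zeroSpan fun h => hp (h.infix ?_)
          rw [arrows_comp]
          exact ⟨[], arrows q, by simp⟩
        · rw [of_mul_of_ne _ _ h]; exact zero_mem _
  | zero => simp
  | add y t _ _ hy ht =>
    rw [add_mul, mul_add]
    exact ⟨add_mem hy.1 ht.1, add_mem hy.2 ht.2⟩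
  | smul c y _ hy =>
    rw [smul_mul_assoc, mul_smul_comm]
    exact ⟨Submodule.smul_mem _ _ hy.1, Submodule.smul_mem _ _ hy.2⟩

/-- The span of the paths with a forbidden pair is itself a two-sided ideal, and each generator of
$I$, being of length two, is such a path. This is what makes coefficients at chains vanish on $I$.
-/
theorem mem_zeroSpan_of_mem (hI : IsAlmostGentle I) {x : PathAlgebra K V} (hx : x ∈ I) :
    x ∈ zeroSpan I := by
  obtain ⟨R, hR, h⟩ := hI.generated
  let J : TwoSidedIdeal (PathAlgebra K V) := TwoSidedIdeal.mk' (zeroSpan I) (zero_mem _)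
    (fun h h' => add_mem h h') (fun h => neg_mem h) (fun h => (mul_mem_zeroSpan _ h).1)
    (fun h => (mul_mem_zeroSpan _ h).2)
  suffices I ≤ J by
    simpa [J] using this hx
  conv_lhs => rw [h]
  rw [TwoSidedIdeal.span_le]
  rintro _ ⟨⟨a, b, p⟩, hp, rfl⟩
  have hpI : of K p ∈ I := by
    rw [h]
    exact TwoSidedIdeal.subset_span ⟨_, hp, rfl⟩
  suffices of K p ∈ zeroSpan I by simpa [J] using this
  refine of_mem_zeroSpan fun hc => ?_
  have hl := hR _ hp
  dsimp only at hl
  cases p with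
  | nil => simp at hl
  | cons p e =>
    cases p with
    | nil => simp at hl
    | cons p f =>
      cases p with
      | nil =>
        simp only [arrows_cons, arrows_nil, List.nil_append, List.cons_append,
          List.isChain_cons_cons] at hc
        refine hc.1 ?_
        rw [ofArrow, ofArrow, of_mul_of]
        exact hpI
      | cons p g => simp at hl

theorem repr_eq_zero_of_mem (hI : IsAlmostGentle I) {x : PathAlgebra K V} (hx : x ∈ I)
    {p : BPath V} (hp : (arrows p.path).IsChain (ArrowRel I)) : (basis K V).repr x p = 0 := by
  have := (Module.Basis.mem_span_image _).1 (mem_zeroSpan_of_mem hI hx)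
  by_contra h
  exact this (Finsupp.mem_support_iff.2 h) hp

theorem of_notMem_iff (hI : IsAlmostGentle I) {a b : V} {p : Path a b} :
    of K p ∉ I ↔ (arrows p).IsChain (ArrowRel I) := by
  refine ⟨fun h => by_contra fun h' => h (of_mem_of_not_isChain p h'), fun h h' => ?_⟩
  have := repr_eq_zero_of_mem hI h' (p := ⟨a, b, p⟩) h
  simp [repr_of] at this

end Quotient

/-! ### Unique extension to a maximal path -/

section Maximal

variable {K : Type z} [Field K] {V : Type u} [Quiver.{w} V] [Fintype V]
  {I : TwoSidedIdeal (PathAlgebra K V)}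

theorem ArrowRel.right_eq_left {a b : Total V} (h : ArrowRel I a b) : b.left = a.right := by
  by_contra hne
  refine h ?_
  rw [ofArrow, ofArrow, of_mul_of_ne _ _ hne]
  exact I.zero_mem

variable (I) in
/-- A nonempty list of arrows that is a path not in `I` and admits no extension by an arrow. -/
structure IsMaximalList (l : List (Total V)) : Prop where
  isChain : l.IsChain (ArrowRel I)
  not_cons : ∀ a, ¬ (a :: l).IsChain (ArrowRel I)
  not_concat : ∀ a, ¬ (l ++ [a]).IsChain (ArrowRel I)

/-- For a nonempty list the chain condition already forces an added arrow to compose with the path.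
The empty list is extended by every arrow of the quiver, so trivial paths have to be excluded. -/
theorem IsMaximalPath.isMaximalList (hI : IsAlmostGentle I) {a b : V} {p : Path a b}
    (h : IsMaximalPath I p) (hp : arrows p ≠ []) : IsMaximalList I (arrows p) := by
  refine ⟨(of_notMem_iff hI).1 h.1, fun e he => ?_, fun e he => ?_⟩
  · obtain ⟨f, l, hfl⟩ := List.exists_cons_of_ne_nil hp
    have hef : f.left = e.right := by
      rw [hfl, List.isChain_cons_cons] at he
      exact he.1.right_eq_left
    obtain ⟨c, f, q, rfl, -⟩ := exists_eq_toPath_comp hfl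
    obtain ⟨el, er, e⟩ := e
    dsimp only at hef
    subst hef
    have := (h.2 ⟨_, _, e⟩).1
    rw [ofArrow, of_mul_of] at this
    refine (of_notMem_iff hI).2 ?_ this
    simpa using he
  · cases p with
    | nil => simp at hp
    | cons p f =>
      have hef : e.left = b := by
        rw [arrows_cons, List.append_assoc, List.isChain_append] at he
        have := he.2.1
        simp only [List.cons_append, List.nil_append, List.isChain_cons_cons] at this
        exact this.1.right_eq_left
      obtain ⟨el, er, e⟩ := e
      dsimp only at hef
      subst hef
      have := (h.2 ⟨_, _, e⟩).2
      rw [ofArrow, of_mul_of] at this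
      refine (of_notMem_iff hI).2 ?_ this
      simpa using he

/-- When each element has at most one successor, chains from a common start follow the same course
until the shorter one stops. -/
theorem isChain_comparable {α : Type*} {R : α → α → Prop}
    (hR : ∀ a b b', R a b → R a b' → b = b') {a : α} {l l' : List α}
    (h : (a :: l).IsChain R) (h' : (a :: l').IsChain R) : l <+: l' ∨ l' <+: l := by
  induction l generalizing a l' with
  | nil => simp
  | cons b l ih =>
    cases l' with
    | nil => simp
    | cons b' l' =>
      rw [List.isChain_cons_cons] at h h'
      obtain rfl := hR _ _ _ h.1 h'.1
      simpa using ih h.2 h'.2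

theorem isChain_eq_of_not_concat {α : Type*} {R : α → α → Prop}
    (hR : ∀ a b b', R a b → R a b' → b = b') {p l l' : List α} (hp : p ≠ [])
    (h : (p ++ l).IsChain R) (h' : (p ++ l').IsChain R)
    (hl : ∀ a, ¬ (p ++ l ++ [a]).IsChain R) (hl' : ∀ a, ¬ (p ++ l' ++ [a]).IsChain R) :
    l = l' := by
  obtain ⟨p, e, rfl⟩ := List.eq_nil_or_concat p |>.resolve_left hp
  have key : ∀ l l' : List α, (p.concat e ++ l').IsChain R →
      (∀ a, ¬ (p.concat e ++ l ++ [a]).IsChain R) → l <+: l' → l = l' := by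
    rintro l _ h' hl ⟨t, rfl⟩
    cases t with
    | nil => simp
    | cons a t =>
      refine absurd (h'.infix ?_) (hl a)
      exact ⟨[], t, by simp⟩
  have h1 := h.infix (l₁ := e :: l) ⟨p, [], by simp⟩
  have h1' := h'.infix (l₁ := e :: l') ⟨p, [], by simp⟩
  rcases isChain_comparable hR h1 h1' with h2 | h2
  · exact key _ _ h' hl h2
  · exact (key _ _ h hl' h2).symm

theorem IsMaximalList.unique (hI : IsAlmostGentle I) {p q r q' r' : List (Total V)}
    (hp : p ≠ []) (h : IsMaximalList I (q ++ p ++ r)) (h' : IsMaximalList I (q' ++ p ++ r')) :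
    q = q' ∧ r = r' := by
  have rel : ∀ {q r : List (Total V)}, IsMaximalList I (q ++ p ++ r) →
      ∀ a, ¬ (p ++ r ++ [a]).IsChain (ArrowRel I) := by
    intro q r h a ha
    obtain ⟨e, p, rfl⟩ := List.exists_cons_of_ne_nil hp
    refine h.not_concat a ?_
    have h0 := h.isChain
    rw [List.append_assoc, List.append_assoc, ← List.append_assoc _ r, List.isChain_append]
    rw [List.append_assoc, List.isChain_append] at h0
    exact ⟨h0.1, ha, by simpa using h0.2.2⟩
  have rel' : ∀ {q r : List (Total V)}, IsMaximalList I (q ++ p ++ r) →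
      ∀ a, ¬ (a :: (q ++ p)).IsChain (ArrowRel I) := by
    intro q r h a ha
    obtain ⟨p, e, rfl⟩ := List.eq_nil_or_concat p |>.resolve_left hp
    refine h.not_cons a ?_
    have h0 := h.isChain
    rw [← List.cons_append, List.isChain_append]
    rw [List.isChain_append] at h0
    refine ⟨ha, h0.2.1, fun x hx => h0.2.2 x ?_⟩
    simpa [List.getLast?_cons] using hx
  constructor
  -- Reversing the lists turns uniqueness of predecessors into uniqueness of successors, so the same
  -- lemma serves both sides.
  · rw [← List.reverse_inj]
    refine isChain_eq_of_not_concat (R := fun a b => ArrowRel I b a) (p := p.reverse)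
      (fun a b b' => hI.left_unique a b b') (by simpa using hp) ?_ ?_ ?_ ?_
    · rw [← List.reverse_append, List.isChain_reverse]
      exact h.isChain.left_of_append
    · rw [← List.reverse_append, List.isChain_reverse]
      exact h'.isChain.left_of_append
    · intro a
      rw [← List.reverse_append, ← List.reverse_cons, List.isChain_reverse]
      exact rel' h a
    · intro a
      rw [← List.reverse_append, ← List.reverse_cons, List.isChain_reverse]
      exact rel' h' a
  · refine isChain_eq_of_not_concat (R := ArrowRel I) (p := p) hI.right_unique hp ?_ ?_
      (rel h) (rel h')
    · exact h.isChain.infix ⟨q, [], by simp⟩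
    · exact h'.isChain.infix ⟨q', [], by simp⟩

end Maximal

/-! ### Paths and cycles of the quiver with the new arrows -/

section StarPaths

variable {K : Type z} [Field K] {V : Type u} [Quiver.{w} V] [Fintype V]
  (I : TwoSidedIdeal (PathAlgebra K V))

/-- The paths of `Q` as paths of `Q^*`. -/
abbrev inclPath {a b : V} (p : Path a b) :
    Path (V := StarQuiver I) ((starIncl I).obj a) ((starIncl I).obj b) :=
  (starIncl I).mapPath p

/-- An arrow of `Q` as an arrow of `Q^*`. -/
def inclArrow (a : Total V) : Total (StarQuiver I) :=
  ⟨(starIncl I).obj a.left, (starIncl I).obj a.right, (starIncl I).map a.hom⟩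

/-- The arrow `a_m` for a bundled maximal path. -/
def newArrow (m : {m : BPath V // IsMaximalPath I m.path}) : Total (StarQuiver I) :=
  ⟨(starIncl I).obj m.1.tgt, (starIncl I).obj m.1.src, starArrow I m.1.path m.2⟩

variable {I} in
@[elab_as_elim]
theorem StarQuiver.cases {P : StarQuiver I → Prop} (obj : ∀ x : V, P ((starIncl I).obj x))
    (v : StarQuiver I) : P v := obj v

variable {I} in
@[elab_as_elim]
theorem StarQuiver.hom_cases {x y : V}
    {P : ((starIncl I).obj x ⟶ (starIncl I).obj y) → Prop}
    (incl : ∀ a : x ⟶ y, P ((starIncl I).map a))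
    (new : ∀ (m : Path y x) (hm : IsMaximalPath I m), P (starArrow I m hm))
    (a : (starIncl I).obj x ⟶ (starIncl I).obj y) : P a :=
  match a with
  | .inl a => incl a
  | .inr m => new m.1 m.2

theorem exists_arrow_eq (e : Total (StarQuiver I)) :
    (∃ a, e = inclArrow I a) ∨ ∃ m, e = newArrow I m := by
  obtain ⟨v, v', a | ⟨m, hm⟩⟩ := e
  · exact Or.inl ⟨⟨v, v', a⟩, rfl⟩
  · exact Or.inr ⟨⟨⟨v', v, m⟩, hm⟩, rfl⟩

variable {I}

variable (I) in
/-- An arrow of `Q^*` is an arrow of `Q` or an arrow `a_m`. -/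
def splitArrow : Total (StarQuiver I) → Total V ⊕ {m : BPath V // IsMaximalPath I m.path}
  | ⟨v, v', Sum.inl a⟩ => Sum.inl ⟨v, v', a⟩
  | ⟨v, v', Sum.inr m⟩ => Sum.inr ⟨⟨v', v, m.1⟩, m.2⟩

theorem inclArrow_injective : Function.Injective (inclArrow I) := fun _ _ h =>
  Sum.inl.inj (congrArg (splitArrow I) h)

theorem newArrow_injective : Function.Injective (newArrow I) := fun _ _ h =>
  Sum.inr.inj (congrArg (splitArrow I) h)

theorem inclArrow_ne_newArrow (a : Total V) (m) : inclArrow I a ≠ newArrow I m := fun h =>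
  Sum.inl_ne_inr (congrArg (splitArrow I) h)

@[simp] theorem arrows_inclPath {a b : V} (p : Path a b) :
    arrows (inclPath I p) = (arrows p).map (inclArrow I) := by
  induction p with
  | nil => rfl
  | cons p e ih => simp [Prefunctor.mapPath_cons, ih, inclArrow]

theorem inclPath_eq_comp {a b : V} {m : Path a b} {c : V}
    {x : Path (V := StarQuiver I) ((starIncl I).obj a) ((starIncl I).obj c)}
    {y : Path (V := StarQuiver I) ((starIncl I).obj c) ((starIncl I).obj b)}
    (h : inclPath I m = x.comp y) :
    ∃ (q : Path a c) (r : Path c b), m = q.comp r ∧ x = inclPath I q ∧ y = inclPath I r := by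
  have h' := congrArg arrows h
  rw [arrows_inclPath, arrows_comp, List.map_eq_append_iff] at h'
  obtain ⟨l₁, l₂, hl, h₁, h₂⟩ := h'
  obtain ⟨c', q, r, rfl, rfl, rfl⟩ := arrows_eq_append hl
  rw [← arrows_inclPath] at h₁
  have := BPath.eq_of_arrows_left _ _ h₁
  obtain ⟨-, h0, h3⟩ := BPath.mk.inj this
  change c' = c at h0
  subst h0
  obtain rfl := eq_of_heq h3
  rw [inclPath, Prefunctor.mapPath_comp, Path.comp_inj_right] at h
  exact ⟨q, r, rfl, rfl, h.symm⟩

/-- The path `r a_m q` of `Q^*`. -/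
def around {a d : V} (m : Path a d) (hm : IsMaximalPath I m) {b c : V} (q : Path a b)
    (r : Path c d) : Path ((starIncl I).obj c) ((starIncl I).obj b) :=
  (inclPath I r).comp ((starArrow I m hm).toPath.comp (inclPath I q))

theorem arrows_around {a d : V} (m : Path a d) (hm : IsMaximalPath I m) {b c : V}
    (q : Path a b) (r : Path c d) :
    arrows (around m hm q r) = (arrows r).map (inclArrow I) ++
      newArrow I ⟨⟨a, d, m⟩, hm⟩ :: (arrows q).map (inclArrow I) := by
  simp [around, newArrow]

theorem comp_around {a d : V} (m : Path a d) (hm : IsMaximalPath I m) {b c e : V} (q : Path a b)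
    (r : Path c d) (p : Path e c) :
    (inclPath I p).comp (around m hm q r) = around m hm q (p.comp r) := by
  simp [around, inclPath, Prefunctor.mapPath_comp, Path.comp_assoc]

/-- A rotation of $m\,a_m$ is given by a cut. A cut after $a_m$ returns $m\,a_m$ itself, with $q$
trivial; any other cut splits $m=qr$ and yields $r\,a_m\,q$. -/
theorem mem_starCycles_iff {x : V} {C : Path ((starIncl I).obj x) ((starIncl I).obj x)} :
    C ∈ starCycles I ((starIncl I).obj x) ↔ ∃ (a d : V) (m : Path a d) (hm : IsMaximalPath I m)
      (q : Path a x) (r : Path x d), m = q.comp r ∧ C = around m hm q r := by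
  constructor
  · rintro ⟨a, d, m, hm, X, Y, hXY, rfl⟩
    rcases cons_eq_comp hXY with h | ⟨Y', rfl, h⟩
    · obtain ⟨h0, -, hY⟩ := BPath.mk.inj h
      change x = a at h0
      subst h0
      obtain rfl := eq_of_heq hY
      refine ⟨x, d, m, hm, .nil, m, (Path.nil_comp m).symm, ?_⟩
      rw [Path.nil_comp, ← Path.comp_nil X, ← hXY]
      rfl
    · obtain ⟨q, r, rfl, rfl, rfl⟩ := inclPath_eq_comp h
      refine ⟨a, d, _, hm, q, r, rfl, ?_⟩
      rw [around, ← Path.comp_assoc]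
      rfl
  · rintro ⟨a, d, _, hm, q, r, rfl, rfl⟩
    refine ⟨a, d, _, hm, inclPath I q, (inclPath I r).comp (starArrow I _ hm).toPath, ?_, ?_⟩
    · rw [starCycle, Prefunctor.mapPath_comp, Path.comp_assoc]
    · rw [around, Path.comp_assoc]

end StarPaths

/-! ### The path basis of the quotient, and existence of maximal paths -/

section PathBasis

variable {K : Type z} [Field K] {V : Type u} [Quiver.{w} V] [Fintype V]
  {I : TwoSidedIdeal (PathAlgebra K V)}

theorem repr_eq_of_quotMk_eq (hI : IsAlmostGentle I) {x y : PathAlgebra K V}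
    (h : quotMk I x = quotMk I y) {p : BPath V} (hp : of K p.path ∉ I) :
    (basis K V).repr x p = (basis K V).repr y p := by
  have := repr_eq_zero_of_mem hI (quotMk_eq_iff.1 h) ((of_notMem_iff hI).1 hp)
  rwa [map_sub, Finsupp.sub_apply, sub_eq_zero] at this

/-- The coefficient of a path outside `I`, as a linear functional on `KQ/I`. -/
def pathCoord (hI : IsAlmostGentle I) (p : BPath V) (hp : of K p.path ∉ I) :
    DualBimodule K (QuotAlgebra I) :=
  -- Any choice of preimages gives a linear map, because the coefficient at $p\notin I$ vanishes on
  -- $I$.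
  ({ toFun := fun x => (basis K V).repr (Function.surjInv quotMk_surjective x) p
     map_add' := fun x y => by
      rw [← Finsupp.add_apply, ← map_add]
      refine repr_eq_of_quotMk_eq hI ?_ hp
      simp only [map_add, Function.surjInv_eq]
     map_smul' := fun c x => by
      rw [RingHom.id_apply, ← Finsupp.smul_apply, ← map_smul]
      refine repr_eq_of_quotMk_eq hI ?_ hp
      simp only [map_smul, Function.surjInv_eq] } : Module.Dual K (QuotAlgebra I))

theorem pathCoord_quotMk (hI : IsAlmostGentle I) (p : BPath V) (hp : of K p.path ∉ I)
    (x : PathAlgebra K V) : pathCoord hI p hp (quotMk I x) = (basis K V).repr x p :=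
  repr_eq_of_quotMk_eq hI (Function.surjInv_eq quotMk_surjective _) hp

variable (I) in
/-- The paths outside `I`. -/
abbrev NonzeroPath := {p : BPath V // of K p.path ∉ I}

/-- The basis of `KQ/I` given by the paths outside `I`. -/
def pathBasis (hI : IsAlmostGentle I) : Module.Basis (NonzeroPath I) K (QuotAlgebra I) :=
  Module.Basis.mk (v := fun p => quotMk I (of K p.1.path))
    (by
      classical
      rw [linearIndependent_iff']
      intro s g hg i hi
      have : quotMk I (∑ j ∈ s, g j • of K j.1.path) = quotMk I 0 := by
        simpa using hg
      have := repr_eq_of_quotMk_eq hI this i.2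
      simpa [repr_of_path, Finsupp.single_apply, Finsupp.finsetSum_apply, ← Subtype.ext_iff,
        Finset.sum_ite_eq', hi] using this)
    (by
      rintro x -
      obtain ⟨x, rfl⟩ := quotMk_surjective x
      induction x using PathAlgebra.induction with
      | h0 => simp
      | hadd x y hx hy => rw [map_add]; exact add_mem hx hy
      | hsmul c x hx => rw [map_smul]; exact Submodule.smul_mem _ _ hx
      | hof a b p =>
        by_cases hp : of K p ∈ I
        · rw [quotMk_eq_zero_iff.2 hp]; exact zero_mem _
        · exact Submodule.subset_span ⟨⟨⟨a, b, p⟩, hp⟩, rfl⟩)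

theorem pathBasis_apply (hI : IsAlmostGentle I) (p : NonzeroPath I) :
    pathBasis hI p = quotMk I (of K p.1.path) := by
  simp [pathBasis]

theorem finite_nonzeroPath (hfin : Module.Finite K (QuotAlgebra I)) (hI : IsAlmostGentle I) :
    Finite (NonzeroPath I) :=
  Module.Finite.finite_basis (pathBasis hI)

/-- Finitely many paths lie outside $I$, so their lengths are bounded by some $N$; prolonging a path
that is not yet maximal lowers $N$ minus its length. An arrow witnessing non-maximality must compose
with the path, since otherwise the product is $0\in I$. -/
theorem exists_isMaximalPath [Finite (NonzeroPath I)] {b c : V} (p : Path b c)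
    (hp : of K p ∉ I) :
    ∃ (a d : V) (q : Path a b) (r : Path c d), IsMaximalPath I (q.comp (p.comp r)) := by
  obtain ⟨N, hN⟩ := (Set.finite_range fun p : NonzeroPath I => p.1.path.length).bddAbove
  have bound : ∀ {b c : V} (p : Path b c), of K p ∉ I → p.length ≤ N := fun p hp =>
    hN ⟨⟨⟨_, _, p⟩, hp⟩, rfl⟩
  induction h : N - p.length using Nat.strong_induction_on generalizing b c p with
  | _ n ih =>
    by_cases hm : IsMaximalPath I p
    · exact ⟨b, c, .nil, .nil, by simpa using hm⟩
    · simp only [IsMaximalPath, hp, not_false_eq_true, true_and, not_forall, not_and_or] at hm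
      obtain ⟨⟨s, t, e⟩, he | he⟩ := hm
      · have hbt : b = t := by
          by_contra hne
          exact he (by rw [ofArrow, of_mul_of_ne _ _ hne]; exact I.zero_mem)
        subst hbt
        rw [ofArrow, of_mul_of] at he
        have hl := bound _ he
        rw [Path.length_comp, Path.length_toPath] at hl
        obtain ⟨a, d, q, r, hm⟩ := ih _ (by rw [← h, Path.length_comp, Path.length_toPath]; omega)
          _ he rfl
        exact ⟨a, d, q.comp e.toPath, r, by simpa only [Path.comp_assoc] using hm⟩
      · have hbt : s = c := by
          by_contra hne
          exact he (by rw [ofArrow, of_mul_of_ne _ _ hne]; exact I.zero_mem)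
        subst hbt
        rw [ofArrow, of_mul_of] at he
        have hl := bound _ he
        rw [Path.length_comp, Path.length_toPath] at hl
        obtain ⟨a, d, q, r, hm⟩ := ih _ (by rw [← h, Path.length_comp, Path.length_toPath]; omega)
          _ he rfl
        exact ⟨a, d, q, e.toPath.comp r, by simpa only [Path.comp_assoc] using hm⟩

theorem of_toPath_notMem (hI : IsAlmostGentle I) {a b : V} (e : a ⟶ b) : of K e.toPath ∉ I :=
  (of_notMem_iff hI).2 (by simp)

theorem of_nil_notMem (hI : IsAlmostGentle I) (a : V) : of K (.nil : Path a a) ∉ I :=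
  (of_notMem_iff hI).2 (by simp)

theorem of_notMem_left {a b c : V} {p : Path a b} {q : Path b c} (h : of K (p.comp q) ∉ I) :
    of K p ∉ I := fun hp => h (by rw [← of_mul_of]; exact I.mul_mem_right _ _ hp)

theorem of_notMem_right {a b c : V} {p : Path a b} {q : Path b c} (h : of K (p.comp q) ∉ I) :
    of K q ∉ I := fun hp => h (by rw [← of_mul_of]; exact I.mul_mem_left _ _ hp)

end PathBasis

/-! ### A spanning family of the star algebra -/

section StarSpan

variable {K : Type z} [Field K] {V : Type u} [Quiver.{w} V] [Fintype V]
  {I : TwoSidedIdeal (PathAlgebra K V)}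

variable (I) in
/-- The relation between consecutive arrows on the cycles of `Q^*`. -/
def StarNext (s t : Total (StarQuiver I)) : Prop :=
  (∃ a b, s = inclArrow I a ∧ t = inclArrow I b ∧ ArrowRel I a b) ∨
  (∃ a m, s = inclArrow I a ∧ t = newArrow I m ∧ ∃ l, arrows m.1.path = l ++ [a]) ∨
  ∃ m b, s = newArrow I m ∧ t = inclArrow I b ∧ ∃ l, arrows m.1.path = b :: l

/-- An arrow $a$ that ends a maximal path has no continuation in $Q$ outside $I$, so it is never
followed both by an old and by a new arrow. Two maximal paths ending in $a$ coincide by unique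
extension, and $a_m$ is followed only by the first arrow of $m$. -/
theorem StarNext.unique (hI : IsAlmostGentle I) {s t t' : Total (StarQuiver I)}
    (h : StarNext I s t) (h' : StarNext I s t') : t = t' := by
  have not_rel : ∀ {a b : Total V} {m : {m : BPath V // IsMaximalPath I m.path}}
      {l : List (Total V)}, arrows m.1.path = l ++ [a] → ¬ ArrowRel I a b := by
    intro a b m l hl hab
    have hm := m.2.isMaximalList hI (by simp [hl])
    refine hm.not_concat b ?_
    have hc := hm.isChain
    rw [List.isChain_append]
    refine ⟨hc, by simp, ?_⟩
    simpa [hl] using hab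
  rcases h with ⟨a, b, rfl, rfl, h⟩ | ⟨a, m, rfl, rfl, l, h⟩ | ⟨m, b, rfl, rfl, l, h⟩ <;>
  rcases h' with ⟨a', b', ha, rfl, h'⟩ | ⟨a', m', ha, rfl, l', h'⟩ | ⟨m', b', ha, rfl, l', h'⟩
  · obtain rfl := inclArrow_injective ha
    rw [hI.right_unique _ _ _ h h']
  · obtain rfl := inclArrow_injective ha
    exact absurd h (not_rel h')
  · exact absurd ha (inclArrow_ne_newArrow _ _)
  · obtain rfl := inclArrow_injective ha
    exact absurd h' (not_rel h)
  · obtain rfl := inclArrow_injective ha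
    have hm := m.2.isMaximalList hI (by simp [h])
    have hm' := m'.2.isMaximalList hI (by simp [h'])
    rw [h] at hm
    rw [h'] at hm'
    obtain ⟨rfl, -⟩ := IsMaximalList.unique hI (p := [a]) (r := []) (r' := []) (by simp)
      (by simpa using hm) (by simpa using hm')
    rw [Subtype.ext (BPath.eq_of_arrows (by simp [h]) (h.trans h'.symm))]
  · exact absurd ha (inclArrow_ne_newArrow _ _)
  · exact absurd ha.symm (inclArrow_ne_newArrow _ _)
  · exact absurd ha.symm (inclArrow_ne_newArrow _ _)
  · obtain rfl := newArrow_injective ha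
    rw [h, List.cons.injEq] at h'
    rw [h'.1]

/-- On $r\,a_m\,q$ with $m=qr$, the steps inside $r$ and $q$ are allowed because $m\notin I$; the
steps at $a_m$, when present, come from the last arrow of $m$ and go to its first. -/
theorem isChain_starNext (hI : IsAlmostGentle I) {x : StarQuiver I} {C : Path x x}
    (h : C ∈ starCycles I x) : (arrows C).IsChain (StarNext I) := by
  cases x using StarQuiver.cases with | _ x
  obtain ⟨a, d, m, hm, q, r, rfl, rfl⟩ := mem_starCycles_iff.1 h
  have hc := (of_notMem_iff hI).1 hm.1
  rw [arrows_comp] at hc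
  have hmap : ∀ l : List (Total V), l.IsChain (ArrowRel I) →
      (l.map (inclArrow I)).IsChain (StarNext I) := fun l hl =>
    List.isChain_map_of_isChain (S := StarNext I) _ (fun a b hab => Or.inl ⟨a, b, rfl, rfl, hab⟩) hl
  rw [arrows_around, List.isChain_append, List.isChain_cons]
  refine ⟨hmap _ hc.right_of_append, ⟨?_, hmap _ hc.left_of_append⟩, ?_⟩
  · intro t ht
    rcases hq : arrows q with _ | ⟨e, l⟩
    · simp [hq] at ht
    · simp only [hq, List.map_cons, List.head?_cons, Option.mem_def, Option.some.injEq] at ht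
      exact Or.inr (Or.inr ⟨_, e, rfl, ht.symm, l ++ arrows r, by simp [hq]⟩)
  · intro s hs t ht
    simp only [List.head?_cons, Option.mem_def, Option.some.injEq] at ht
    rcases List.eq_nil_or_concat (arrows r) with hr | ⟨l, e, hr⟩
    · simp [hr] at hs
    · simp only [hr, List.concat_eq_append, List.map_append, List.map_cons, List.map_nil,
        List.getLast?_append, List.getLast?_singleton, Option.some_or, Option.mem_def,
        Option.some.injEq] at hs
      exact Or.inr (Or.inl ⟨e, _, hs.symm, ht.symm, arrows q ++ l, by simp [hr]⟩)

variable (I) in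
/-- The ideal `I^*`. -/
abbrev starIdeal : TwoSidedIdeal (PathAlgebra K (StarQuiver I)) :=
  TwoSidedIdeal.span {x | CycleRel K (starCycles I) (fun _ _ => 1) x}

variable (I) in
/-- The class in `A^*` of a path of `Q^*`. -/
def starMk {a b : StarQuiver I} (p : Path a b) : StarAlgebra I := quotMk (starIdeal I) (of K p)

theorem starMk_comp {a b c : StarQuiver I} (p : Path a b) (q : Path b c) :
    starMk I (p.comp q) = starMk I p * starMk I q := by
  rw [starMk, starMk, starMk, ← map_mul, of_mul_of]

theorem starMk_congr {a b c d : StarQuiver I} {p : Path a b} {q : Path c d}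
    (h : (⟨a, b, p⟩ : BPath (StarQuiver I)) = ⟨c, d, q⟩) : starMk I p = starMk I q :=
  congrArg (fun p : BPath (StarQuiver I) => starMk I p.path) h

theorem starMk_eq_of_mem {x : StarQuiver I} {C C' : Path x x} (h : C ∈ starCycles I x)
    (h' : C' ∈ starCycles I x) : starMk I C = starMk I C' := by
  rw [starMk, starMk, quotMk_eq_iff]
  refine TwoSidedIdeal.subset_span ?_
  simpa using CycleRel.type1 (K := K) (S := starCycles I) (μ := fun _ _ => 1) x ⟨C, h⟩ ⟨C', h'⟩

theorem starMk_mul_eq_zero_of_mem {x y : StarQuiver I} {a : x ⟶ y} {q : Path y x}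
    (h : a.toPath.comp q ∈ starCycles I x) :
    starMk I (a.toPath.comp q) * starMk I a.toPath = 0 := by
  rw [starMk, starMk, ← map_mul, quotMk_eq_zero_iff]
  refine TwoSidedIdeal.subset_span ?_
  simpa using CycleRel.type2 (K := K) (S := starCycles I) (μ := fun _ _ => 1) x ⟨_, h⟩ y a q rfl

theorem starMk_mul_eq_zero (hI : IsAlmostGentle I) {x y t : StarQuiver I} {a : x ⟶ y} {b : y ⟶ t}
    (h : ¬ StarNext I ⟨x, y, a⟩ ⟨y, t, b⟩) : starMk I a.toPath * starMk I b.toPath = 0 := by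
  rw [starMk, starMk, ← map_mul, quotMk_eq_zero_iff]
  refine TwoSidedIdeal.subset_span (CycleRel.type3 _ _ _ a b ?_)
  rintro v ⟨C, hC⟩ ⟨p, q, hpq⟩
  have := (isChain_starNext hI hC).infix (l₁ := [⟨x, y, a⟩, ⟨y, t, b⟩])
    ⟨arrows p, arrows q, by simp [show C = _ from hpq]⟩
  exact h (by simpa using this)

/-- The path `x` starts some cycle. -/
def IsInitial {v w : StarQuiver I} (x : Path v w) : Prop :=
  ∃ y : Path w v, x.comp y ∈ starCycles I v

theorem isInitial_nil [Finite (NonzeroPath I)] (hI : IsAlmostGentle I) (v : StarQuiver I) :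
    IsInitial (.nil : Path v v) := by
  cases v using StarQuiver.cases with | _ v
  obtain ⟨a, d, q, r, hm⟩ := exists_isMaximalPath (.nil : Path v v) (of_nil_notMem hI v)
  refine ⟨around _ hm q r, ?_⟩
  rw [Path.nil_comp]
  exact mem_starCycles_iff.2 ⟨_, _, _, hm, q, r, by simp, rfl⟩

theorem isInitial_toPath [Finite (NonzeroPath I)] (hI : IsAlmostGentle I) {v w : StarQuiver I}
    (e : v ⟶ w) : IsInitial e.toPath := by
  cases v using StarQuiver.cases with | _ v
  cases w using StarQuiver.cases with | _ w
  rcases e with e | ⟨m, hm⟩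
  · obtain ⟨a, d, q, r, hm⟩ := exists_isMaximalPath _ (of_toPath_notMem hI e)
    refine ⟨around _ hm q r, ?_⟩
    exact mem_starCycles_iff.2 ⟨_, _, _, hm, q, _, rfl, comp_around _ hm q r e.toPath⟩
  · refine ⟨inclPath I m, ?_⟩
    exact mem_starCycles_iff.2 ⟨w, v, m, hm, m, .nil, rfl, (Path.nil_comp _).symm⟩

/-- Append one arrow $c$ to an initial segment. If the cycle is already complete, Types 1 and 2 give
zero; otherwise $c$ is the unique allowed successor of the last arrow or Type 3 gives zero. -/
theorem starMk_eq_zero_or_isInitial [Finite (NonzeroPath I)] (hI : IsAlmostGentle I)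
    {v w : StarQuiver I} (x : Path v w) : starMk I x = 0 ∨ IsInitial x := by
  induction x with
  | nil => exact Or.inr (isInitial_nil hI v)
  | cons x c ih =>
    have hcons : starMk I (x.cons c) = starMk I x * starMk I c.toPath := starMk_comp x c.toPath
    rcases ih with h0 | ⟨y, hy⟩
    · left; rw [hcons, h0, zero_mul]
    · rcases hl : arrows y with _ | ⟨d, l⟩
      · left
        -- Type 1 replaces the full cycle $x$ by one whose first arrow is $c$, which is the form
        -- Type 2 needs.
        obtain ⟨y', hy'⟩ := isInitial_toPath hI c
        have := BPath.eq_of_arrows_left y .nil hl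
        obtain ⟨-, rfl, h⟩ := BPath.mk.inj this
        obtain rfl := eq_of_heq h
        have h2 : starMk I x = _ := starMk_eq_of_mem hy hy'
        rw [hcons, h2, starMk_mul_eq_zero_of_mem hy']
      · cases x with
        | nil =>
          right
          exact isInitial_toPath hI c
        | cons x f =>
          have hc := (isChain_starNext hI hy).infix (l₁ := [⟨_, _, f⟩, d])
            ⟨arrows x, l, by simp [hl]⟩
          simp only [List.isChain_cons_cons, List.isChain_singleton, and_true] at hc
          by_cases hn : StarNext I ⟨_, _, f⟩ ⟨_, _, c⟩
          · right
            obtain rfl := hc.unique hI hn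
            obtain ⟨c', f', q, h, rfl, -⟩ := exists_eq_toPath_comp hl
            obtain ⟨-, rfl, h⟩ := Total.mk.inj h
            obtain rfl := eq_of_heq h
            rw [← Path.comp_assoc] at hy
            exact ⟨q, hy⟩
          · left
            have : starMk I (x.cons f) = starMk I x * starMk I f.toPath :=
              starMk_comp x f.toPath
            rw [hcons, this, mul_assoc, starMk_mul_eq_zero hI hn, mul_zero]

/-- The path `x = r a_m q` of `Q^*` with `m = q p r` is a complement of the path `p` of `Q`. -/
def IsComplement {b c : V} (p : Path b c)
    (x : Path ((starIncl I).obj c) ((starIncl I).obj b)) : Prop :=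
  ∃ (a d : V) (m : Path a d) (hm : IsMaximalPath I m) (q : Path a b) (r : Path c d),
    m = q.comp (p.comp r) ∧ x = around m hm q r

/-- A nontrivial $p$ has only one complement, by unique extension. The complements of a trivial path
are the cycles of $\mathcal S$ at its vertex, which Type 1 identifies. -/
theorem IsComplement.starMk_eq (hI : IsAlmostGentle I) {b c : V} {p : Path b c}
    {x x' : Path ((starIncl I).obj c) ((starIncl I).obj b)} (h : IsComplement p x)
    (h' : IsComplement p x') : starMk I x = starMk I x' := by
  obtain ⟨a, d, _, hm, q, r, rfl, rfl⟩ := h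
  obtain ⟨a', d', _, hm', q', r', rfl, rfl⟩ := h'
  by_cases hp : arrows p = []
  · obtain ⟨-, rfl, hp⟩ := BPath.mk.inj (BPath.eq_of_arrows_left p .nil hp)
    obtain rfl := eq_of_heq hp
    refine starMk_eq_of_mem ?_ ?_ <;>
    exact mem_starCycles_iff.2 ⟨_, _, _, _, _, _, by rw [Path.nil_comp], rfl⟩
  · have h1 := hm.isMaximalList hI (by simp [hp])
    have h2 := hm'.isMaximalList hI (by simp [hp])
    simp only [arrows_comp, ← List.append_assoc] at h1 h2
    obtain ⟨hq, hr⟩ := h1.unique hI hp h2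
    obtain ⟨rfl, -, hq⟩ := BPath.mk.inj (BPath.eq_of_arrows_right _ _ hq)
    obtain ⟨-, rfl, hr⟩ := BPath.mk.inj (BPath.eq_of_arrows_left _ _ hr)
    obtain rfl := eq_of_heq hq
    obtain rfl := eq_of_heq hr
    rfl

theorem exists_isComplement [Finite (NonzeroPath I)] (p : NonzeroPath I) :
    ∃ x : Path ((starIncl I).obj p.1.tgt) ((starIncl I).obj p.1.src),
      IsComplement p.1.path x := by
  obtain ⟨a, d, q, r, hm⟩ := exists_isMaximalPath p.1.path p.2
  exact ⟨_, a, d, _, hm, q, r, rfl, rfl⟩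

variable (I) in
/-- The paths of `Q^*` whose classes form a basis of `A^*`. -/
def starGen [Finite (NonzeroPath I)] : NonzeroPath I ⊕ NonzeroPath I → StarAlgebra I
  | .inl p => starMk I (inclPath I p.1.path)
  | .inr p => starMk I (exists_isComplement p).choose

theorem IsInitial.exists_starGen_eq [Finite (NonzeroPath I)] (hI : IsAlmostGentle I)
    {v w : StarQuiver I} {x : Path v w} (h : IsInitial x) : ∃ j, starMk I x = starGen I j := by
  obtain ⟨y, h⟩ := h
  cases v using StarQuiver.cases with | _ v
  obtain ⟨a, d, m, hm, q, r, rfl, h⟩ := mem_starCycles_iff.1 h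
  have old : ∀ l, (arrows r).map (inclArrow I) = arrows x ++ l →
      ∃ j, starMk I x = starGen I j := by
    intro l hl
    rw [List.map_eq_append_iff] at hl
    obtain ⟨l₁, l₂, hl, h₁, -⟩ := hl
    obtain ⟨c, r₁, r₂, rfl, rfl, rfl⟩ := arrows_eq_append hl
    refine ⟨.inl ⟨⟨_, _, r₁⟩, of_notMem_left (of_notMem_right hm.1)⟩, starMk_congr ?_⟩
    refine BPath.eq_of_arrows_left _ _ ?_
    rw [arrows_inclPath, h₁]
  have h' := congrArg arrows h
  -- The segment $x$ of $r\,a_m\,q$ either stops within $r$, and is then a path of $Q$, or passes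
  -- $a_m$ and is a complement of the rest of $q$.
  rw [arrows_comp, arrows_around, List.append_eq_append_iff] at h'
  rcases h' with ⟨l, hr, -⟩ | ⟨l, hx, hl⟩
  · exact old l hr
  · cases l with
    | nil => exact old [] (by simp [hx])
    | cons e l =>
      rw [List.cons_append, List.cons.injEq, List.map_eq_append_iff] at hl
      obtain ⟨rfl, l₁, l₂, hl, rfl, -⟩ := hl
      obtain ⟨c, q₁, q₂, rfl, rfl, rfl⟩ := arrows_eq_append hl
      let p : NonzeroPath I := ⟨⟨_, _, q₂⟩, of_notMem_right (of_notMem_left hm.1)⟩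
      refine ⟨.inr p, ?_⟩
      have hc : IsComplement q₂ (around _ hm q₁ r) :=
        ⟨_, _, _, hm, q₁, r, by rw [Path.comp_assoc], rfl⟩
      refine Eq.trans (starMk_congr ?_) (hc.starMk_eq hI (exists_isComplement p).choose_spec)
      refine BPath.eq_of_arrows_left _ _ ?_
      rw [arrows_around, hx]

theorem span_starGen [Finite (NonzeroPath I)] (hI : IsAlmostGentle I) :
    Submodule.span K (Set.range (starGen I)) = ⊤ := by
  rw [eq_top_iff]
  rintro x -
  obtain ⟨x, rfl⟩ := quotMk_surjective x
  induction x using PathAlgebra.induction with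
  | h0 => simp
  | hadd x y hx hy => rw [map_add]; exact add_mem hx hy
  | hsmul c x hx => rw [map_smul]; exact Submodule.smul_mem _ _ hx
  | hof a b p =>
    rcases starMk_eq_zero_or_isInitial hI p with h | h
    · rw [← starMk, h]; exact zero_mem _
    · obtain ⟨j, hj⟩ := h.exists_starGen_eq hI
      exact Submodule.subset_span ⟨j, hj.symm⟩

end StarSpan

/-! ### Homomorphisms out of a path algebra -/

section PathLift

variable {K : Type z} [Field K] {V : Type u} [Quiver.{w} V] {B : Type*} [Ring B] [Algebra K B]

/-- Values in a ring for the vertices and the arrows of a quiver that satisfy the relations between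
the trivial paths and the arrows. -/
structure IsPathValuation (e : V → B) (f : Total V → B) : Prop where
  idem : ∀ v, e v * e v = e v
  orth : ∀ v v', v ≠ v' → e v * e v' = 0
  left : ∀ a, e a.left * f a = f a
  right : ∀ a, f a * e a.right = f a

/-- The product of the values of the arrows of a path. -/
def pathVal (e : V → B) (f : Total V → B) {a : V} : ∀ {b : V}, Path a b → B
  | _, .nil => e a
  | _, .cons p x => pathVal e f p * f ⟨_, _, x⟩

namespace IsPathValuation

variable {e : V → B} {f : Total V → B}

theorem pathVal_mul_right (h : IsPathValuation e f) {a b : V} (p : Path a b) :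
    pathVal e f p * e b = pathVal e f p := by
  cases p with
  | nil => exact h.idem _
  | cons p x => rw [pathVal, mul_assoc, h.right ⟨_, _, x⟩]

theorem mul_pathVal_left (h : IsPathValuation e f) {a b : V} (p : Path a b) :
    e a * pathVal e f p = pathVal e f p := by
  induction p with
  | nil => exact h.idem _
  | cons p x ih => rw [pathVal, ← mul_assoc, ih]

theorem pathVal_comp (h : IsPathValuation e f) {a b c : V} (p : Path a b) (q : Path b c) :
    pathVal e f (p.comp q) = pathVal e f p * pathVal e f q := by
  induction q with
  | nil => exact (h.pathVal_mul_right p).symm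
  | cons q x ih => rw [Path.comp_cons, pathVal, ih, pathVal, mul_assoc]

theorem pathVal_toPath (h : IsPathValuation e f) {a b : V} (x : a ⟶ b) :
    pathVal e f x.toPath = f ⟨a, b, x⟩ :=
  h.left ⟨a, b, x⟩

theorem pathVal_mul_pathVal_of_ne (h : IsPathValuation e f) {a b c d : V} (p : Path a b)
    (q : Path c d) (hne : c ≠ b) : pathVal e f p * pathVal e f q = 0 := by
  rw [← h.pathVal_mul_right p, ← h.mul_pathVal_left q, mul_assoc, ← mul_assoc (e b),
    h.orth _ _ hne.symm, zero_mul, mul_zero]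

/-- The homomorphism from the path algebra given by a valuation. -/
def lift [Fintype V] (h : IsPathValuation e f) (hsum : ∑ v, e v = 1) : PathAlgebra K V →ₐ[K] B :=
  let φ : PathAlgebra K V →ₗ[K] B := (basis K V).constr K fun p => pathVal e f p.path
  have hφ : ∀ {a b : V} (p : Path a b), φ (of K p) = pathVal e f p := fun p =>
    (basis K V).constr_basis K _ _
  AlgHom.ofLinearMap φ
    (by rw [one_def, map_sum, ← hsum]; exact Finset.sum_congr rfl fun v _ => hφ _)
    (by
      intro x y
      induction x using PathAlgebra.induction with
      | h0 => simp
      | hadd x x' hx hx' => rw [add_mul, map_add, map_add, add_mul, hx, hx']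
      | hsmul c x hx => rw [smul_mul_assoc, map_smul, map_smul, smul_mul_assoc, hx]
      | hof a b p =>
        induction y using PathAlgebra.induction with
        | h0 => simp
        | hadd x x' hx hx' => rw [mul_add, map_add, map_add, mul_add, hx, hx']
        | hsmul c x hx => rw [mul_smul_comm, map_smul, map_smul, mul_smul_comm, hx]
        | hof c d q =>
          by_cases hcb : c = b
          · subst hcb
            rw [of_mul_of, hφ, hφ, hφ, h.pathVal_comp]
          · rw [of_mul_of_ne _ _ hcb, hφ, hφ, h.pathVal_mul_pathVal_of_ne _ _ hcb, map_zero])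

theorem lift_of [Fintype V] (h : IsPathValuation e f) (hsum : ∑ v, e v = 1) {a b : V}
    (p : Path a b) : h.lift hsum (of K p) = pathVal e f p :=
  (basis K V).constr_basis K _ _

end IsPathValuation

end PathLift

/-! ### Descent to the quotient by a generated ideal -/

section QuotLift

variable {R A B : Type*} [CommRing R] [Ring A] [Algebra R A] [Ring B] [Algebra R B]

theorem ringCon_span_le_ker {S : Set A} (φ : A →ₐ[R] B) (h : ∀ x ∈ S, φ x = 0) :
    (TwoSidedIdeal.span S).ringCon ≤ RingCon.ker φ.toRingHom := by
  have : TwoSidedIdeal.span S ≤ TwoSidedIdeal.ker φ :=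
    TwoSidedIdeal.span_le.2 fun x hx => (TwoSidedIdeal.mem_ker φ).2 (h x hx)
  intro x y hxy
  rw [TwoSidedIdeal.rel_iff] at hxy
  have := (TwoSidedIdeal.mem_ker φ).1 (this hxy)
  rw [map_sub, sub_eq_zero] at this
  exact this

end QuotLift

/-! ### The bimodule action on coordinate functionals -/

section PathCoord

variable {K : Type z} [Field K] {V : Type u} [Quiver.{w} V] [Fintype V]
  {I : TwoSidedIdeal (PathAlgebra K V)}

open Classical in
-- Left multiplication by $q$ is injective on the paths composable with it, so $qp$ arises in $qy$
-- only from $p$.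
theorem repr_of_mul {a b c : V} (q : Path a b) (p : Path b c) (y : PathAlgebra K V) :
    (basis K V).repr (of K q * y) ⟨a, c, q.comp p⟩ = (basis K V).repr y ⟨b, c, p⟩ := by
  induction y using PathAlgebra.induction with
  | h0 => simp
  | hadd x y hx hy => simp only [mul_add, map_add, Finsupp.add_apply, hx, hy]
  | hsmul k x hx => simp only [mul_smul_comm, map_smul, Finsupp.smul_apply, hx]
  | hof b' c' x =>
    by_cases hb : b' = b
    · subst hb
      rw [of_mul_of, repr_of, repr_of, Finsupp.single_apply, Finsupp.single_apply]
      refine if_congr ?_ rfl rfl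
      constructor
      · intro h
        obtain ⟨-, rfl, h⟩ := BPath.mk.inj h
        rw [Path.comp_injective_right _ (eq_of_heq h)]
      · intro h
        obtain ⟨-, rfl, h⟩ := BPath.mk.inj h
        rw [eq_of_heq h]
    · rw [of_mul_of_ne _ _ hb, repr_of, map_zero, Finsupp.zero_apply, Finsupp.single_apply,
        if_neg fun h => hb (BPath.mk.inj h).1]

open Classical in
theorem repr_mul_of {a b c : V} (p : Path a b) (r : Path b c) (y : PathAlgebra K V) :
    (basis K V).repr (y * of K r) ⟨a, c, p.comp r⟩ = (basis K V).repr y ⟨a, b, p⟩ := by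
  induction y using PathAlgebra.induction with
  | h0 => simp
  | hadd x y hx hy => simp only [add_mul, map_add, Finsupp.add_apply, hx, hy]
  | hsmul k x hx => simp only [smul_mul_assoc, map_smul, Finsupp.smul_apply, hx]
  | hof a' b' x =>
    by_cases hb : b = b'
    · subst hb
      rw [of_mul_of, repr_of, repr_of, Finsupp.single_apply, Finsupp.single_apply]
      refine if_congr ?_ rfl rfl
      constructor
      · intro h
        obtain ⟨rfl, -, h⟩ := BPath.mk.inj h
        rw [Path.comp_injective_left _ (eq_of_heq h)]
      · intro h
        obtain ⟨rfl, -, h⟩ := BPath.mk.inj h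
        rw [eq_of_heq h]
    · rw [of_mul_of_ne _ _ hb, repr_of, map_zero, Finsupp.zero_apply, Finsupp.single_apply,
        if_neg fun h => hb (BPath.mk.inj h).2.1.symm]

open Classical in
-- Every path occurring in $qy$ starts with $q$.
theorem repr_of_mul_eq_zero {a b c d : V} (q : Path a b) (m : Path c d) (y : PathAlgebra K V)
    (h : ∀ p : Path b d, (⟨a, d, q.comp p⟩ : BPath V) ≠ ⟨c, d, m⟩) :
    (basis K V).repr (of K q * y) ⟨c, d, m⟩ = 0 := by
  induction y using PathAlgebra.induction with
  | h0 => simp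
  | hadd x y hx hy => simp only [mul_add, map_add, Finsupp.add_apply, hx, hy, add_zero]
  | hsmul k x hx => simp only [mul_smul_comm, map_smul, Finsupp.smul_apply, hx, smul_zero]
  | hof b' c' x =>
    by_cases hb : b' = b
    · subst hb
      rw [of_mul_of, repr_of, Finsupp.single_apply, if_neg]
      intro h'
      obtain ⟨-, rfl, -⟩ := BPath.mk.inj h'
      exact h x h'
    · rw [of_mul_of_ne _ _ hb, map_zero, Finsupp.zero_apply]

open Classical in
theorem repr_mul_of_eq_zero {a b c d : V} (r : Path a b) (m : Path c d) (y : PathAlgebra K V)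
    (h : ∀ p : Path c a, (⟨c, b, p.comp r⟩ : BPath V) ≠ ⟨c, d, m⟩) :
    (basis K V).repr (y * of K r) ⟨c, d, m⟩ = 0 := by
  induction y using PathAlgebra.induction with
  | h0 => simp
  | hadd x y hx hy => simp only [add_mul, map_add, Finsupp.add_apply, hx, hy, add_zero]
  | hsmul k x hx => simp only [smul_mul_assoc, map_smul, Finsupp.smul_apply, hx, smul_zero]
  | hof a' b' x =>
    by_cases hb : a = b'
    · subst hb
      rw [of_mul_of, repr_of, Finsupp.single_apply, if_neg]
      intro h'
      obtain ⟨rfl, -, -⟩ := BPath.mk.inj h'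
      exact h x h'
    · rw [of_mul_of_ne _ _ hb, map_zero, Finsupp.zero_apply]

/-- The left action strips a path off the end of the dual path, $r\,(pr)^*=p^*$; the right action
below strips one off its start. -/
theorem quotMk_smul_pathCoord (hI : IsAlmostGentle I) {a b c : V} (p : Path a b) (r : Path b c)
    (h : of K (p.comp r) ∉ I) :
    quotMk I (of K r) • pathCoord hI ⟨a, c, p.comp r⟩ h =
      pathCoord hI ⟨a, b, p⟩ (of_notMem_left h) := by
  ext x
  obtain ⟨x, rfl⟩ := quotMk_surjective x
  rw [DualBimodule.left_smul_apply, ← map_mul, pathCoord_quotMk, pathCoord_quotMk, repr_mul_of]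

theorem op_quotMk_smul_pathCoord (hI : IsAlmostGentle I) {a b c : V} (q : Path a b)
    (p : Path b c) (h : of K (q.comp p) ∉ I) :
    op (quotMk I (of K q)) • pathCoord hI ⟨a, c, q.comp p⟩ h =
      pathCoord hI ⟨b, c, p⟩ (of_notMem_right h) := by
  ext x
  obtain ⟨x, rfl⟩ := quotMk_surjective x
  rw [DualBimodule.right_smul_apply, unop_op, ← map_mul, pathCoord_quotMk, pathCoord_quotMk,
    repr_of_mul]

theorem quotMk_smul_pathCoord_eq_zero (hI : IsAlmostGentle I) {a b c d : V} (r : Path a b)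
    (m : Path c d) (hm : of K m ∉ I)
    (h : ∀ p : Path c a, (⟨c, b, p.comp r⟩ : BPath V) ≠ ⟨c, d, m⟩) :
    quotMk I (of K r) • pathCoord hI ⟨c, d, m⟩ hm = 0 := by
  ext x
  obtain ⟨x, rfl⟩ := quotMk_surjective x
  rw [DualBimodule.left_smul_apply, ← map_mul, pathCoord_quotMk, repr_mul_of_eq_zero _ _ _ h,
    DualBimodule.zero_apply]

theorem op_quotMk_smul_pathCoord_eq_zero (hI : IsAlmostGentle I) {a b c d : V} (q : Path a b)
    (m : Path c d) (hm : of K m ∉ I)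
    (h : ∀ p : Path b d, (⟨a, d, q.comp p⟩ : BPath V) ≠ ⟨c, d, m⟩) :
    op (quotMk I (of K q)) • pathCoord hI ⟨c, d, m⟩ hm = 0 := by
  ext x
  obtain ⟨x, rfl⟩ := quotMk_surjective x
  rw [DualBimodule.right_smul_apply, unop_op, ← map_mul, pathCoord_quotMk,
    repr_of_mul_eq_zero _ _ _ h, DualBimodule.zero_apply]

end PathCoord

/-! ### The isomorphism with the trivial extension -/

section TrivialExtensionIso

variable {K : Type z} [Field K] {V : Type u} [Quiver.{w} V] [Fintype V]
  {I : TwoSidedIdeal (PathAlgebra K V)}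

variable (I) in
/-- The value in `T(A)` of a vertex of `Q^*`. -/
def starVertexVal (v : StarQuiver I) : TrivialExtension K (QuotAlgebra I) :=
  inl (quotMk I (of K (Path.nil (V := V) (a := v))))

/-- The value in `T(A)` of an arrow of `Q^*`: arrows of `Q` go to their classes in `A`, and `a_m`
goes to the element of the dual basis given by `m`. -/
def starArrowVal (hI : IsAlmostGentle I) (s : Total (StarQuiver I)) :
    TrivialExtension K (QuotAlgebra I) :=
  match splitArrow I s with
  | .inl a => inl (quotMk I (ofArrow K a))
  | .inr m => inr (pathCoord hI m.1 m.2.1)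

theorem isPathValuation_star (hI : IsAlmostGentle I) :
    IsPathValuation (starVertexVal I) (starArrowVal hI) where
  idem v := by
    cases v using StarQuiver.cases with | _ v
    change inl (quotMk I (of K (Path.nil : Path v v))) *
      inl (quotMk I (of K (Path.nil : Path v v))) = inl (quotMk I (of K (Path.nil : Path v v)))
    rw [← inl_mul, ← map_mul, of_mul_of, Path.comp_nil]
  orth v v' h := by
    cases v using StarQuiver.cases with | _ v
    cases v' using StarQuiver.cases with | _ v'
    change inl (quotMk I (of K (Path.nil : Path v v))) *
      inl (quotMk I (of K (Path.nil : Path v' v'))) = 0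
    rw [← inl_mul, ← map_mul, of_mul_of_ne _ _ (show v' ≠ v from Ne.symm h), map_zero,
      inl_zero]
  left s := by
    rcases exists_arrow_eq I s with ⟨⟨a, b, e⟩, rfl⟩ | ⟨⟨⟨a, b, m⟩, hm⟩, rfl⟩
    · change inl (quotMk I (of K (Path.nil : Path a a))) * inl (quotMk I (of K e.toPath)) =
        inl (quotMk I (of K e.toPath))
      rw [← inl_mul, ← map_mul, of_mul_of, Path.nil_comp]
    · change inl (quotMk I (of K (Path.nil : Path b b))) * inr (pathCoord hI ⟨a, b, m⟩ hm.1) =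
        inr (pathCoord hI ⟨a, b, m⟩ hm.1)
      rw [inl_mul_inr]
      exact congrArg inr (quotMk_smul_pathCoord hI m .nil hm.1)
  right s := by
    rcases exists_arrow_eq I s with ⟨⟨a, b, e⟩, rfl⟩ | ⟨⟨⟨a, b, m⟩, hm⟩, rfl⟩
    · change inl (quotMk I (of K e.toPath)) * inl (quotMk I (of K (Path.nil : Path b b))) =
        inl (quotMk I (of K e.toPath))
      rw [← inl_mul, ← map_mul, of_mul_of, Path.comp_nil]
    · change inr (pathCoord hI ⟨a, b, m⟩ hm.1) * inl (quotMk I (of K (Path.nil : Path a a))) =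
        inr (pathCoord hI ⟨a, b, m⟩ hm.1)
      rw [inr_mul_inl]
      have hm' : of K (Path.nil.comp m) ∉ I := by rw [Path.nil_comp]; exact hm.1
      have := op_quotMk_smul_pathCoord hI .nil m hm'
      simp only [Path.nil_comp] at this
      rw [this]

theorem sum_starVertexVal : ∑ v, starVertexVal I v = 1 := by
  have h : ∑ v : V, quotMk I (of K (Path.nil : Path v v)) = 1 := by
    rw [← map_sum, ← one_def, map_one]
  have h' := congrArg (inlHom (QuotAlgebra I) (DualBimodule K (QuotAlgebra I))) h
  rw [map_sum, map_one] at h'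
  exact h'

/-- The homomorphism `KQ^* → T(A)`. -/
def starLift (hI : IsAlmostGentle I) :
    PathAlgebra K (StarQuiver I) →ₐ[K] TrivialExtension K (QuotAlgebra I) :=
  (isPathValuation_star hI).lift sum_starVertexVal

theorem starLift_of_comp (hI : IsAlmostGentle I) {a b c : StarQuiver I} (p : Path a b)
    (q : Path b c) : starLift hI (of K (p.comp q)) =
      starLift hI (of K p) * starLift hI (of K q) := by
  rw [← map_mul, of_mul_of]

theorem starLift_toPath (hI : IsAlmostGentle I) {a b : StarQuiver I} (e : a ⟶ b) :
    starLift hI (of K e.toPath) = starArrowVal hI ⟨a, b, e⟩ := by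
  rw [starLift, IsPathValuation.lift_of, (isPathValuation_star hI).pathVal_toPath]

theorem starLift_inclPath (hI : IsAlmostGentle I) {a b : V} (p : Path a b) :
    starLift hI (of K (inclPath I p)) = inl (quotMk I (of K p)) := by
  induction p with
  | nil => rw [starLift, IsPathValuation.lift_of]; rfl
  | cons p e ih =>
    refine (starLift_of_comp hI (inclPath I p) ((starIncl I).map e).toPath).trans ?_
    rw [ih, starLift_toPath]
    change _ * inl (quotMk I (of K e.toPath)) = _
    rw [← inl_mul, ← map_mul, of_mul_of]
    rfl

theorem starLift_map (hI : IsAlmostGentle I) {a b : V} (e : a ⟶ b) :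
    starLift hI (of K ((starIncl I).map e).toPath) = inl (quotMk I (of K e.toPath)) := by
  rw [starLift_toPath]
  rfl

theorem starLift_starArrow (hI : IsAlmostGentle I) {a b : V} (m : Path a b)
    (hm : IsMaximalPath I m) :
    starLift hI (of K (starArrow I m hm).toPath) = inr (pathCoord hI ⟨a, b, m⟩ hm.1) := by
  rw [starLift_toPath]
  rfl

theorem starLift_around (hI : IsAlmostGentle I) {a b c d : V} (q : Path a b) (p : Path b c)
    (r : Path c d) (hm : IsMaximalPath I (q.comp (p.comp r))) :
    starLift hI (of K (around _ hm q r)) =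
      inr (pathCoord hI ⟨b, c, p⟩ (of_notMem_left (of_notMem_right hm.1))) := by
  rw [around, starLift_of_comp, starLift_of_comp, starLift_inclPath, starLift_inclPath,
    starLift_starArrow, inr_mul_inl, inl_mul_inr, op_quotMk_smul_pathCoord,
    quotMk_smul_pathCoord]

/-- A cycle $r\,a_m\,q$ with $m=qr$ is a complement of the trivial path at $x$. The value does not
depend on the cycle, which is Type 1. -/
theorem starLift_of_mem (hI : IsAlmostGentle I) {x : V}
    {C : Path ((starIncl I).obj x) ((starIncl I).obj x)}
    (h : C ∈ starCycles I ((starIncl I).obj x)) :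
    starLift hI (of K C) = inr (pathCoord hI ⟨x, x, .nil⟩ (of_nil_notMem hI x)) := by
  obtain ⟨a, d, m, hm, q, r, hqr, rfl⟩ := mem_starCycles_iff.1 h
  obtain rfl : m = q.comp (Path.nil.comp r) := by rw [Path.nil_comp, hqr]
  exact starLift_around hI q .nil r hm

/-- If $ab\notin I$, then $ab$ lies on $C_m$ for a maximal $m$ containing it. If $a\,m^*\ne0$, then
$m$ ends in $a$, so $a\,a_m$ lies on $C_m$; if $m^*b\ne0$, then $m=bp$, so $a_m\,b$ lies on the
rotation $p\,a_m\,b$. Two new arrows multiply to zero because $D(A)^2=0$. -/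
theorem starLift_mul_eq_zero [Finite (NonzeroPath I)] (hI : IsAlmostGentle I)
    {x y t : StarQuiver I} (a : x ⟶ y) (b : y ⟶ t)
    (h : ∀ (v : StarQuiver I) (C : starCycles I v), ¬ LiesOn (a.toPath.comp b.toPath) C.1) :
    starLift hI (of K a.toPath) * starLift hI (of K b.toPath) = 0 := by
  cases x using StarQuiver.cases with | _ x
  cases y using StarQuiver.cases with | _ y
  cases t using StarQuiver.cases with | _ t
  have hcycle : ∀ {v w : V} (m : Path v w) (hm : IsMaximalPath I m) {s : V} (q : Path v s)
      (r : Path s w), m = q.comp r → ¬ LiesOn (a.toPath.comp b.toPath) (around m hm q r) :=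
    fun m hm s q r hqr => h s ⟨_, mem_starCycles_iff.2 ⟨_, _, m, hm, q, r, hqr, rfl⟩⟩
  cases a using StarQuiver.hom_cases with
  | incl a =>
    cases b using StarQuiver.hom_cases with
    | incl b =>
      rw [starLift_map, starLift_map, ← inl_mul, ← map_mul, of_mul_of]
      by_cases hab : of K (a.toPath.comp b.toPath) ∈ I
      · rw [quotMk_eq_zero_iff.2 hab, inl_zero]
      · obtain ⟨v, w, q, r, hm⟩ := exists_isMaximalPath _ hab
        refine absurd ⟨inclPath I q, (inclPath I r).comp (starArrow I _ hm).toPath, ?_⟩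
          (hcycle _ hm .nil _ (Path.nil_comp _).symm)
        simp only [around, inclPath, Prefunctor.mapPath_comp, Path.comp_assoc]
        rfl
    | new m hm =>
      rw [starLift_map, starLift_starArrow, inl_mul_inr, quotMk_smul_pathCoord_eq_zero, inr_zero]
      intro p hp
      obtain ⟨-, -, hp⟩ := BPath.mk.inj hp
      obtain rfl := eq_of_heq hp
      refine hcycle _ hm .nil _ (Path.nil_comp _).symm ⟨inclPath I p, .nil, ?_⟩
      simp only [around, inclPath, Prefunctor.mapPath_comp, Path.comp_assoc]
      rfl
  | new m hm =>
    cases b using StarQuiver.hom_cases with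
    | incl b =>
      rw [starLift_starArrow, starLift_map, inr_mul_inl, op_quotMk_smul_pathCoord_eq_zero,
        inr_zero]
      intro p hp
      obtain ⟨-, -, hp⟩ := BPath.mk.inj hp
      obtain rfl := eq_of_heq hp
      exact hcycle _ hm b.toPath p rfl ⟨inclPath I p, .nil, rfl⟩
    | new m' hm' => rw [starLift_starArrow, starLift_starArrow, inr_mul_inr]

theorem starLift_eq_zero [Finite (NonzeroPath I)] (hI : IsAlmostGentle I)
    (x : PathAlgebra K (StarQuiver I)) (h : CycleRel K (starCycles I) (fun _ _ => 1) x) :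
    starLift hI x = 0 := by
  cases h with
  | type1 v C C' =>
    cases v using StarQuiver.cases with | _ v
    simp only [PNat.one_coe, pow_one, map_sub]
    rw [starLift_of_mem hI C.2, starLift_of_mem hI C'.2, sub_self]
  | type2 v C v' a q h =>
    cases v using StarQuiver.cases with | _ v
    cases v' using StarQuiver.cases with | _ v'
    simp only [PNat.one_coe, pow_one, map_mul]
    rw [starLift_of_mem hI C.2]
    cases a using StarQuiver.hom_cases with
    | incl a =>
      rw [starLift_map, inr_mul_inl, op_quotMk_smul_pathCoord_eq_zero, inr_zero]
      -- The functional $e_x^*a$ reads the coefficient of a trivial path in $ay$, where every path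
      -- has positive length.
      intro p hp
      have := congrArg (fun p : BPath V => p.path.length) hp
      simp [Path.length_comp] at this
    | new m hm => rw [starLift_starArrow, inr_mul_inr]
  | type3 _ _ _ a b h =>
    rw [map_mul]
    exact starLift_mul_eq_zero hI a b h

/-- The homomorphism `A^* → T(A)`. -/
def starHom [Finite (NonzeroPath I)] (hI : IsAlmostGentle I) :
    StarAlgebra I →ₐ[K] TrivialExtension K (QuotAlgebra I) :=
  (starIdeal I).ringCon.liftₐ (starLift hI) (ringCon_span_le_ker _ (starLift_eq_zero hI))

theorem starHom_starMk [Finite (NonzeroPath I)] (hI : IsAlmostGentle I) {a b : StarQuiver I}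
    (p : Path a b) : starHom hI (starMk I p) = starLift hI (of K p) := rfl

open Classical in
/-- The basis of `T(A)` formed by the paths outside `I` and the dual basis. -/
def trivialExtensionBasis [Finite (NonzeroPath I)] (hI : IsAlmostGentle I) :
    Module.Basis (NonzeroPath I ⊕ NonzeroPath I) K (TrivialExtension K (QuotAlgebra I)) :=
  ((pathBasis hI).prod (pathBasis hI).dualBasis :
    Module.Basis _ K (QuotAlgebra I × Module.Dual K (QuotAlgebra I)))

open Classical in
theorem trivialExtensionBasis_inl [Finite (NonzeroPath I)] (hI : IsAlmostGentle I)
    (p : NonzeroPath I) :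
    trivialExtensionBasis hI (.inl p) = inl (quotMk I (of K p.1.path)) := by
  rw [← pathBasis_apply hI]
  refine Prod.ext ?_ ?_
  · exact Module.Basis.prod_apply_inl_fst (pathBasis hI) (pathBasis hI).dualBasis p
  · exact Module.Basis.prod_apply_inl_snd (pathBasis hI) (pathBasis hI).dualBasis p

theorem trivialExtensionBasis_inr [Finite (NonzeroPath I)] (hI : IsAlmostGentle I)
    (p : NonzeroPath I) :
    trivialExtensionBasis hI (.inr p) = inr (pathCoord hI p.1 p.2) := by
  classical
  refine Prod.ext ?_ ?_
  · exact Module.Basis.prod_apply_inr_fst (pathBasis hI) (pathBasis hI).dualBasis p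
  · refine (Module.Basis.prod_apply_inr_snd (pathBasis hI) (pathBasis hI).dualBasis p).trans ((pathBasis hI).ext fun q => ?_)
    change (pathBasis hI).dualBasis p (pathBasis hI q) = pathCoord hI p.1 p.2 (pathBasis hI q)
    rw [pathBasis_apply, pathCoord_quotMk, repr_of_path, ← pathBasis_apply hI,
      Module.Basis.dualBasis_apply_self, Finsupp.single_apply]
    simp only [Subtype.ext_iff]

theorem starHom_starGen [Finite (NonzeroPath I)] (hI : IsAlmostGentle I)
    (j : NonzeroPath I ⊕ NonzeroPath I) :
    starHom hI (starGen I j) = trivialExtensionBasis hI j := by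
  rcases j with p | p
  · rw [trivialExtensionBasis_inl, starGen, starHom_starMk, starLift_inclPath]
  · rw [trivialExtensionBasis_inr, starGen, starHom_starMk]
    obtain ⟨a, d, m, hm, q, r, rfl, h⟩ := (exists_isComplement p).choose_spec
    rw [h, starLift_around]

/-- The linear map sending the basis of $T(A)$ back to `starGen` is a two-sided inverse: one
composite is checked on a spanning family, the other on a basis. Linear independence of `starGen` is
not needed beforehand. -/
theorem starHom_bijective [Finite (NonzeroPath I)] (hI : IsAlmostGentle I) :
    Function.Bijective (starHom hI) := by
  let ψ := (trivialExtensionBasis hI).constr K (starGen I)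
  have hψ : ∀ j, ψ (trivialExtensionBasis hI j) = starGen I j :=
    (trivialExtensionBasis hI).constr_basis K _
  have h1 : ψ ∘ₗ (starHom hI).toLinearMap = LinearMap.id := by
    refine LinearMap.ext_on_range (span_starGen hI) fun j => ?_
    simp [starHom_starGen, hψ]
  have h2 : (starHom hI).toLinearMap ∘ₗ ψ = LinearMap.id := by
    refine (trivialExtensionBasis hI).ext fun j => ?_
    simp [starHom_starGen, hψ]
  exact ⟨Function.LeftInverse.injective (g := ψ) fun x => LinearMap.congr_fun h1 x,
    Function.RightInverse.surjective (g := ψ) fun x => LinearMap.congr_fun h2 x⟩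

end TrivialExtensionIso

end AlmostGentle

end

theorem theorem4p3 {K : Type z} [Field K] {V : Type u} [Fintype V] [Quiver.{w} V]
    (I : TwoSidedIdeal (AlmostGentle.PathAlgebra K V))
    (hfin : Module.Finite K (AlmostGentle.QuotAlgebra I))
    (hI : AlmostGentle.IsAlmostGentle I) :
    Nonempty (AlmostGentle.StarAlgebra I ≃ₐ[K]
      AlmostGentle.TrivialExtension K (AlmostGentle.QuotAlgebra I)) := by
  have := AlmostGentle.finite_nonzeroPath hfin hI
  exact ⟨AlgEquiv.ofBijective (AlmostGentle.starHom hI) (AlmostGentle.starHom_bijective hI)⟩
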